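/- Let $N\ge 1$ and let $\kappa:\mathbb R\times\mathbb R\times\mathbb R^N\times\mathbb R^N\to\mathbb R$ be a homogeneous jump kernel, that is, a Borel function such that for almost every $(x,y)\in\mathbb R^N\times\mathbb R^N$ and all $a,b,c,d\in\mathbb R$: (A1) $\kappa(a,b;x,y)\ge 0$; (A2) $\kappa(a,b;x,y)=\kappa(b,a;y,x)$; (A3) $(a-b)\,\kappa(a,b;x,y)\ge (c-d)\,\kappa(c,d;x,y)$ whenever $a\ge c\ge d\ge b$; (A4) $\kappa(a,b;x,y)$ depends on $x,y$ only through $|x-y|$; (A5) for every $R>0$ there is $m_R:[0,\infty)\to[0,\infty)$ with $\sup_{-R\le a,b\le R}\kappa(a,b;x,y)\le m_R(|x-y|)$ and $\int_{\mathbb R^N}\min(1,|y|)\,m_R(|y|)\,dy<\infty$; (A6) $\kappa$ is continuous in $(a,b)$, and for every $\varepsilon>0$ and $R>\varepsilon$ there is a constant $C_{R,\varepsilon}$ with $|\kappa(a,b;x,y)-\kappa(c,d;x,y)|\le C_{R,\varepsilon}(|a-c|+|b-d|)\,m_R(|x-y|)$ for all $a,b,c,d\in[-R,R]$ with $|a-b|\ge\varepsilon$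 and $|c-d|\ge\varepsilon$. Put $(\mathcal L_v w)(x)=\int_{\mathbb R^N}[w(x)-w(y)]\,\kappa(v(x),v(y);x,y)\,dy$ and consider the problem $$\partial_t u+\mathcal L_u u=0\ \text{ on } (0,\infty)\times\mathbb R^N,\qquad u(0)=u_0. \qquad (*)$$ $BV(\mathbb R^N)$ is the space of $w\in L^1(\mathbb R^N)$ whose distributional partial derivatives are finite signed Radon measures $\lambda_1,\dots,\lambda_N$, with the norm $\|w\|_{BV}=2\|w\|_1+|Dw|(\mathbb R^N)$, where $|Dw|(\mathbb R^N)=\sum_{i=1}^N\sup\{\int\Phi_i\,d\lambda_i:\Phi\in C_0(\mathbb R^N,\mathbb R^N),\ \|\Phi\|_\infty<1\}$. A function $u\in L^\infty([0,\infty)\times\mathbb R^N)$ is a very weak solution of $(*)$ if $$\int_0^\infty\int_{\mathbb R^N}u(t,x)\,\big[\partial_t\psi-\mathcal L_{u(t)}\psi(t,\cdot)\big](t,x)\,dx\,dt=0\quad\text{for every }\psi\in C_c^\infty((0,\infty)\times\mathbb R^N)$$ and $u(t)\to u_0$ in $L^1_{\mathrm{loc}}(\mathbb R^N)$ as $t\to0^+$.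 It is a strong solution if in addition $$u\in L^\infty\big([0,\infty),BV(\mathbb R^N)\cap L^\infty(\mathbb R^N)\big)\cap C\big([0,\infty),L^1_{\mathrm{loc}}(\mathbb R^N)\big).$$ **Theorem.** Let $u$ and $v$ be strong solutions of $(*)$ with initial data $u_0,v_0\in BV(\mathbb R^N)\cap L^\infty(\mathbb R^N)$, respectively. Then: (i) ($L^1$-contraction) $\|u(t)-v(t)\|_1\le\|u_0-v_0\|_1$ for every $t>0$; (ii) (uniqueness) if $u_0=v_0$ almost everywhere, then for every $t\ge0$ one has $u(t,x)=v(t,x)$ for almost every $x\in\mathbb R^N$; (iii) (comparison principle) if $u_0\le v_0$ almost everywhere, then for every $t\ge0$ one has $u(t,x)\le v(t,x)$ for almost every $x\in\mathbb R^N$. -/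

import Mathlib

open MeasureTheory Set Filter Topology
open scoped ENNReal NNReal ContDiff

/-- A homogeneous jump kernel `κ(a, b; x, y)` on `ℝᴺ`. The conditions on slices hold for almost
every `(x, y)`, and for all values `a, b, c, d`. -/
structure IsHomogeneousJumpKernel {N : ℕ}
    (κ : ℝ → ℝ → EuclideanSpace ℝ (Fin N) → EuclideanSpace ℝ (Fin N) → ℝ) : Prop where
  /-- `κ` is a Borel function of all its variables. -/
  borel : Measurable
    fun q : (ℝ × ℝ) × (EuclideanSpace ℝ (Fin N) × EuclideanSpace ℝ (Fin N)) =>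
      κ q.1.1 q.1.2 q.2.1 q.2.2
  /-- `κ` is non-negative. -/
  nonneg : ∀ᵐ p : EuclideanSpace ℝ (Fin N) × EuclideanSpace ℝ (Fin N),
    ∀ a b : ℝ, 0 ≤ κ a b p.1 p.2
  /-- `κ` is symmetric. -/
  symmetric : ∀ᵐ p : EuclideanSpace ℝ (Fin N) × EuclideanSpace ℝ (Fin N),
    ∀ a b : ℝ, κ a b p.1 p.2 = κ b a p.2 p.1
  /-- `κ` is monotone. -/
  monotone : ∀ᵐ p : EuclideanSpace ℝ (Fin N) × EuclideanSpace ℝ (Fin N),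
    ∀ a b c d : ℝ, c ≤ a → d ≤ c → b ≤ d →
      (c - d) * κ c d p.1 p.2 ≤ (a - b) * κ a b p.1 p.2
  /-- `κ` depends on `x, y` only through `|x - y|`. -/
  homogeneous : ∃ k : ℝ → ℝ → ℝ → ℝ,
    ∀ᵐ p : EuclideanSpace ℝ (Fin N) × EuclideanSpace ℝ (Fin N),
      ∀ a b : ℝ, κ a b p.1 p.2 = k a b ‖p.1 - p.2‖
  /-- `κ` is continuous with respect to the first two variables. -/
  continuous : ∀ᵐ p : EuclideanSpace ℝ (Fin N) × EuclideanSpace ℝ (Fin N),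
    Continuous fun ab : ℝ × ℝ => κ ab.1 ab.2 p.1 p.2
  /-- Majorants `m R` which are densities of Lévy measures with low singularity, and for which `κ`
  is locally Lipschitz continuous in the first two variables away from the diagonal `a = b`. -/
  majorant : ∃ m : ℝ → ℝ → ℝ, ∀ R : ℝ, 0 < R →
    (∀ r : ℝ, 0 ≤ r → 0 ≤ m R r) ∧
    (∀ᵐ p : EuclideanSpace ℝ (Fin N) × EuclideanSpace ℝ (Fin N),
      ∀ a ∈ Icc (-R) R, ∀ b ∈ Icc (-R) R, κ a b p.1 p.2 ≤ m R ‖p.1 - p.2‖) ∧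
    Integrable (fun y : EuclideanSpace ℝ (Fin N) => min 1 ‖y‖ * m R ‖y‖) ∧
    (∀ ε : ℝ, 0 < ε → ε < R → ∃ C : ℝ,
      ∀ᵐ p : EuclideanSpace ℝ (Fin N) × EuclideanSpace ℝ (Fin N),
        ∀ a ∈ Icc (-R) R, ∀ b ∈ Icc (-R) R, ∀ c ∈ Icc (-R) R, ∀ d ∈ Icc (-R) R,
          ε ≤ |a - b| → ε ≤ |c - d| →
            |κ a b p.1 p.2 - κ c d p.1 p.2| ≤ C * (|a - c| + |b - d|) * m R ‖p.1 - p.2‖)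

/-- The operator `(𝓛_v w)(x) = ∫ [w(x) - w(y)] κ(v(x), v(y); x, y) dy`. -/
noncomputable def jumpOperator {N : ℕ}
    (κ : ℝ → ℝ → EuclideanSpace ℝ (Fin N) → EuclideanSpace ℝ (Fin N) → ℝ)
    (v w : EuclideanSpace ℝ (Fin N) → ℝ) (x : EuclideanSpace ℝ (Fin N)) : ℝ :=
  ∫ y, (w x - w y) * κ (v x) (v y) x y

/-- The finite signed measures `l i` are the distributional partial derivatives `∂ᵢ w`. -/
def IsDistribGradient {N : ℕ} (w : EuclideanSpace ℝ (Fin N) → ℝ)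
    (l : Fin N → SignedMeasure (EuclideanSpace ℝ (Fin N))) : Prop :=
  ∀ (i : Fin N) (φ : EuclideanSpace ℝ (Fin N) → ℝ), ContDiff ℝ ∞ φ → HasCompactSupport φ →
    ∫ x, w x * fderiv ℝ φ x (EuclideanSpace.single i 1) = -∫ᵛ x, φ x ∂•(l i)

/-- `∑ᵢ sup {∫ Φᵢ dlᵢ : Φ ∈ C₀(ℝᴺ, ℝᴺ), ‖Φ‖ < 1}`. -/
noncomputable def gradientMass {N : ℕ}
    (l : Fin N → SignedMeasure (EuclideanSpace ℝ (Fin N))) : ℝ≥0∞ :=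
  ∑ i : Fin N, ⨆ (Φ : ZeroAtInftyContinuousMap (EuclideanSpace ℝ (Fin N))
      (EuclideanSpace ℝ (Fin N))) (_ : ‖Φ‖ < 1), ENNReal.ofReal (∫ᵛ x, (Φ x) i ∂•(l i))

/-- `|Dw|(ℝᴺ)`: the mass of the distributional gradient of `w` if this gradient consists of finite
signed measures (which are then unique), and `∞` otherwise. -/
noncomputable def bvVariation {N : ℕ} (w : EuclideanSpace ℝ (Fin N) → ℝ) : ℝ≥0∞ :=
  ⨅ (l : Fin N → SignedMeasure (EuclideanSpace ℝ (Fin N))) (_ : IsDistribGradient w l),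
    gradientMass l

/-- `‖w‖_BV = 2 ‖w‖₁ + |Dw|(ℝᴺ)`. -/
noncomputable def bvNorm {N : ℕ} (w : EuclideanSpace ℝ (Fin N) → ℝ) : ℝ≥0∞ :=
  2 * eLpNorm w 1 volume + bvVariation w

/-- `w ∈ BV(ℝᴺ)`. -/
def MemBV {N : ℕ} (w : EuclideanSpace ℝ (Fin N) → ℝ) : Prop :=
  MemLp w 1 volume ∧ bvNorm w < ⊤

/-- `u ∈ L^∞([0,∞) × ℝᴺ)` is a very weak solution of `∂ₜu + 𝓛_u u = 0` with initial value `u₀`,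
which is attained in `L¹_loc`. Only the values `u t` with `0 ≤ t` matter. -/
structure IsVeryWeakSolution {N : ℕ}
    (κ : ℝ → ℝ → EuclideanSpace ℝ (Fin N) → EuclideanSpace ℝ (Fin N) → ℝ)
    (u₀ : EuclideanSpace ℝ (Fin N) → ℝ) (u : ℝ → EuclideanSpace ℝ (Fin N) → ℝ) : Prop where
  memLp_top : MemLp (fun p : ℝ × EuclideanSpace ℝ (Fin N) => u p.1 p.2) ∞
    ((volume.restrict (Ici (0 : ℝ))).prod volume)
  equation : ∀ ψ : ℝ × EuclideanSpace ℝ (Fin N) → ℝ,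
    ContDiff ℝ ∞ ψ → HasCompactSupport ψ → tsupport ψ ⊆ Ioi (0 : ℝ) ×ˢ univ →
      ∫ t in Ioi (0 : ℝ), ∫ x, u t x *
        (deriv (fun s => ψ (s, x)) t - jumpOperator κ (u t) (fun z => ψ (t, z)) x) = 0
  initial : ∀ K : Set (EuclideanSpace ℝ (Fin N)), IsCompact K →
    Tendsto (fun t => eLpNorm (fun x => u t x - u₀ x) 1 (volume.restrict K)) (𝓝[>] 0) (𝓝 0)

/-- `u` is a strong solution: a very weak solution which belongs to
`L^∞([0,∞), BV(ℝᴺ) ∩ L^∞(ℝᴺ)) ∩ C([0,∞), L¹_loc(ℝᴺ))`. -/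
structure IsStrongSolution {N : ℕ}
    (κ : ℝ → ℝ → EuclideanSpace ℝ (Fin N) → EuclideanSpace ℝ (Fin N) → ℝ)
    (u₀ : EuclideanSpace ℝ (Fin N) → ℝ) (u : ℝ → EuclideanSpace ℝ (Fin N) → ℝ) : Prop
    extends IsVeryWeakSolution κ u₀ u where
  bounded_bv : ∃ C : ℝ≥0, ∀ᵐ t ∂(volume.restrict (Ici (0 : ℝ))),
    MemBV (u t) ∧ MemLp (u t) ∞ volume ∧ bvNorm (u t) + eLpNorm (u t) ∞ volume ≤ C
  locallyIntegrable : ∀ t : ℝ, 0 ≤ t → LocallyIntegrable (u t) volume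
  continuous_L1loc : ∀ t : ℝ, 0 ≤ t → ∀ K : Set (EuclideanSpace ℝ (Fin N)), IsCompact K →
    Tendsto (fun s => eLpNorm (fun x => u s x - u t x) 1 (volume.restrict K))
      (𝓝[Ici 0] t) (𝓝 0)

/-! Bounded variation turns the very weak equation into an integrated equation in `L¹`, where the
monotonicity of the kernel gives T-accretivity, and hence contraction.

Translations of a BV function `w` satisfy `‖w(· + z) - w‖₁ ≤ C min(1, |z|)`, which is exactly the
weight against which the Lévy majorant is integrable. So `(w(x) - w(y)) κ(w(x), w(y); x, y)` is
integrable over pairs, uniformly in time along a strong solution, and `𝓛_u u` lies in `L¹`. By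
symmetry of `κ` the operator passes from the test function to `u`; testing with products `θ(t) φ(x)`
then gives `u(t) = u₀ - ∫₀ᵗ 𝓛_u u ds` for every `t` (`IsStrongSolution.exists_representation`).

For two solutions, symmetrizing `∫ 1_{u > v} (𝓛_u u - 𝓛_v v)` produces a double integral whose
integrand is nonnegative, because `(a - b) κ(a, b)` increases in `a` and decreases in `b`
(`integral_indicator_mul_jumpOperator_sub_nonneg`). At almost every `x` the difference `u - v` is
absolutely continuous in time, so the chain rule for the positive part and Fubini show that `∫ (u -
v)⁺` is at most its initial value (`integral_max_zero_sub_integral_le`). Using this in both orders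
yields all three claims. -/

/-! ### Translation estimates for functions of bounded variation -/

/-- Duality between `L¹` and smooth compactly supported functions bounded by one. -/
theorem lintegral_enorm_le_of_forall_contDiff {E : Type*} [NormedAddCommGroup E]
    [NormedSpace ℝ E] [FiniteDimensional ℝ E] [MeasurableSpace E] [BorelSpace E]
    {μ : Measure E} [μ.IsAddHaarMeasure] {f : E → ℝ} (hf : Integrable f μ) {C : ℝ}
    (h : ∀ φ : E → ℝ, ContDiff ℝ ∞ φ → HasCompactSupport φ → (∀ x, |φ x| ≤ 1) →
      ∫ x, f x * φ x ∂μ ≤ C) :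
    ∫⁻ x, ‖f x‖ₑ ∂μ ≤ ENNReal.ofReal C := by
  have hball : ∀ R : ℝ, ∫ x in Metric.closedBall 0 R, ‖f x‖ ∂μ ≤ C := by
    -- The sign of `f` need not be integrable, so it is cut off to a ball and then mollified into
    -- admissible test functions.
    intro R
    set g₀ : E → ℝ := fun x => if 0 ≤ hf.1.mk f x then 1 else -1 with hg₀
    have hg₀m : Measurable g₀ := Measurable.ite
      (measurableSet_le measurable_const hf.1.stronglyMeasurable_mk.measurable)
      measurable_const measurable_const
    set g : E → ℝ := (Metric.closedBall 0 R).indicator g₀ with hg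
    have hg₀1 : ∀ x, |g₀ x| ≤ 1 := by
      intro x
      simp only [hg₀]
      split_ifs <;> simp
    have hg1 : ∀ x, |g x| ≤ 1 := by
      intro x
      simp only [hg, indicator]
      split_ifs
      · exact hg₀1 x
      · simp
    have hgc : HasCompactSupport g :=
      HasCompactSupport.intro (isCompact_closedBall 0 R) fun x hx => by simp [hg, hx]
    have hgi : Integrable g μ := by
      rw [hg, integrable_indicator_iff Metric.isClosed_closedBall.measurableSet]
      exact Measure.integrableOn_of_bounded (M := 1)
        (isCompact_closedBall _ _).measure_lt_top.ne hg₀m.aestronglyMeasurable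
        (Eventually.of_forall hg₀1)
    -- Comparable inner and outer radii are what almost everywhere convergence of the mollification
    -- requires.
    obtain ⟨ρ, hρ, hρ'⟩ : ∃ ρ : ℕ → ContDiffBump (0 : E), Tendsto (fun n => (ρ n).rOut) atTop (𝓝 0) ∧
        ∀ n, (ρ n).rOut ≤ 2 * (ρ n).rIn := by
      refine ⟨fun n => ⟨1 / (n + 1) / 2, 1 / (n + 1), by positivity, half_lt_self (by positivity)⟩, ?_, ?_⟩
      · exact tendsto_one_div_add_atTop_nhds_zero_nat
      · intro n; simp; linarith
    set φ : ℕ → E → ℝ := fun n => convolution ((ρ n).normed μ) g (ContinuousLinearMap.lsmul ℝ ℝ) μ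
    have hlim : ∀ᵐ x ∂μ, Tendsto (fun n => φ n x) atTop (𝓝 (g x)) :=
      ContDiffBump.ae_convolution_tendsto_right_of_locallyIntegrable hρ
        (Eventually.of_forall hρ') hgi.locallyIntegrable
    have hφ1 : ∀ n x, |φ n x| ≤ 1 := by
      intro n x
      calc |φ n x| ≤ ∫ y, (ρ n).normed μ y ∂μ := by
            rw [← Real.norm_eq_abs]
            refine norm_integral_le_of_norm_le (ρ n).integrable_normed (Eventually.of_forall ?_)
            intro y
            simp only [ContinuousLinearMap.lsmul_apply, smul_eq_mul, norm_mul, Real.norm_eq_abs,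
              abs_of_nonneg ((ρ n).nonneg_normed y)]
            exact mul_le_of_le_one_right ((ρ n).nonneg_normed y) (hg1 _)
        _ = 1 := (ρ n).integral_normed
    have hφs : ∀ n, ContDiff ℝ ∞ (φ n) := fun n =>
      (ρ n).hasCompactSupport_normed.contDiff_convolution_left _ (ρ n).contDiff_normed
        hgi.locallyIntegrable
    have hφc : ∀ n, HasCompactSupport (φ n) := fun n =>
      (ρ n).hasCompactSupport_normed.convolution _ hgc
    have hint : Tendsto (fun n => ∫ x, f x * φ n x ∂μ) atTop (𝓝 (∫ x, f x * g x ∂μ)) := by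
      refine tendsto_integral_of_dominated_convergence (fun x => ‖f x‖)
        (fun n => hf.1.mul (hφs n).continuous.aestronglyMeasurable) hf.norm ?_ ?_
      · intro n
        refine Eventually.of_forall fun x => ?_
        rw [norm_mul]
        exact mul_le_of_le_one_right (norm_nonneg _) (hφ1 n x)
      · filter_upwards [hlim] with x hx using hx.const_mul _
    have := le_of_tendsto' hint fun n => h _ (hφs n) (hφc n) (hφ1 n)
    rw [← integral_indicator Metric.isClosed_closedBall.measurableSet]
    refine le_trans (le_of_eq (integral_congr_ae ?_)) this
    filter_upwards [hf.1.ae_eq_mk] with x hx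
    by_cases hxR : x ∈ Metric.closedBall 0 R
    · simp only [hg, indicator_of_mem hxR, hg₀, ← hx, Real.norm_eq_abs]
      split_ifs with h0
      · rw [abs_of_nonneg h0, mul_one]
      · rw [abs_of_neg (not_le.1 h0), mul_neg_one]
    · simp [hg, hxR]
  have hlim : Tendsto (fun n : ℕ => ∫ x in Metric.closedBall 0 (n : ℝ), ‖f x‖ ∂μ) atTop
      (𝓝 (∫ x, ‖f x‖ ∂μ)) := by
    have := (aecover_closedBall (μ := μ) (x := (0 : E)) tendsto_natCast_atTop_atTop).integral_tendsto_of_countably_generated hf.norm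
    exact this
  have hC : ∫ x, ‖f x‖ ∂μ ≤ C := le_of_tendsto' hlim fun n => hball n
  rw [← ofReal_integral_norm_eq_lintegral_enorm hf]
  exact ENNReal.ofReal_le_ofReal hC

/-- The strict bound selects one gradient below the threshold, without knowing that the infimum is
attained. The fields `± (1/2) φ eᵢ` have norm strictly below one, hence are admissible; this halving
is the source of the factor 2. -/
theorem exists_isDistribGradient_of_bvVariation_lt {N : ℕ} {w : EuclideanSpace ℝ (Fin N) → ℝ}
    {M : ℝ} (hM : bvVariation w < ENNReal.ofReal M) :
    ∃ l, IsDistribGradient w l ∧ ∀ (i : Fin N) (φ : EuclideanSpace ℝ (Fin N) → ℝ),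
      Continuous φ → HasCompactSupport φ → (∀ x, |φ x| ≤ 1) → |∫ᵛ x, φ x ∂•(l i)| ≤ 2 * M := by
  obtain ⟨l, hl⟩ := iInf_lt_iff.1 hM
  obtain ⟨hgrad, hmass⟩ := iInf_lt_iff.1 hl
  have hM0 : 0 < M := ENNReal.ofReal_pos.1 (lt_of_le_of_lt zero_le hM)
  have key : ∀ (i : Fin N) (c : ℝ) (φ : EuclideanSpace ℝ (Fin N) → ℝ), |c| = 1 / 2 →
      Continuous φ → HasCompactSupport φ → (∀ x, |φ x| ≤ 1) → c * ∫ᵛ x, φ x ∂•(l i) ≤ M := by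
    intro i c φ hc hφ hφc hφ1
    have hcont : Continuous fun x => EuclideanSpace.single i (c * φ x) := by
      have : (fun x => EuclideanSpace.single i (c * φ x)) =
          fun x => (c * φ x) • EuclideanSpace.single i (1 : ℝ) := by
        ext x j; simp
      rw [this]
      fun_prop
    let Φ : ZeroAtInftyContinuousMap (EuclideanSpace ℝ (Fin N)) (EuclideanSpace ℝ (Fin N)) :=
      ⟨⟨_, hcont⟩, by
        have : HasCompactSupport fun x => EuclideanSpace.single i (c * φ x) :=
          hφc.comp_left (g := fun r => EuclideanSpace.single i (c * r)) (by simp)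
        exact this.is_zero_at_infty⟩
    have hΦ : ‖Φ‖ < 1 := by
      have : ‖Φ‖ ≤ 1 / 2 := by
        rw [← ZeroAtInftyContinuousMap.norm_toBCF_eq_norm]
        refine (BoundedContinuousFunction.norm_le (by norm_num)).2 fun x => ?_
        change ‖EuclideanSpace.single i (c * φ x)‖ ≤ 1 / 2
        rw [PiLp.norm_single, norm_mul, Real.norm_eq_abs, Real.norm_eq_abs, hc]
        linarith [hφ1 x]
      linarith
    have h1 : ENNReal.ofReal (∫ᵛ x, (Φ x) i ∂•(l i)) ≤ gradientMass l :=
      (le_iSup₂ (f := fun (Φ : ZeroAtInftyContinuousMap (EuclideanSpace ℝ (Fin N))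
          (EuclideanSpace ℝ (Fin N))) (_ : ‖Φ‖ < 1) => ENNReal.ofReal (∫ᵛ x, (Φ x) i ∂•(l i)))
        Φ hΦ).trans (Finset.single_le_sum (f := fun i => ⨆ (Φ : ZeroAtInftyContinuousMap
          (EuclideanSpace ℝ (Fin N)) (EuclideanSpace ℝ (Fin N))) (_ : ‖Φ‖ < 1),
          ENNReal.ofReal (∫ᵛ x, (Φ x) i ∂•(l i))) (fun _ _ => zero_le) (Finset.mem_univ i))
    have h2 : (∫ᵛ x, (Φ x) i ∂•(l i)) = c * ∫ᵛ x, φ x ∂•(l i) := by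
      have : (fun x => (Φ x) i) = fun x => c • φ x := by
        ext x
        change (EuclideanSpace.single i (c * φ x)) i = _
        simp
      rw [this]
      exact VectorMeasure.integral_fun_smul ..
    rw [h2] at h1
    exact (ENNReal.ofReal_le_ofReal_iff hM0.le).1 (h1.trans hmass.le)
  refine ⟨l, hgrad, fun i φ hφ hφc hφ1 => abs_le.2 ⟨?_, ?_⟩⟩
  · have := key i (-(1 / 2)) φ (by norm_num) hφ hφc hφ1
    linarith
  · have := key i (1 / 2) φ (by norm_num) hφ hφc hφ1
    linarith

/-- Translations of a function of bounded variation are Lipschitz continuous in `L¹`. -/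
theorem lintegral_translate_sub_le_of_bvVariation_lt {N : ℕ} {w : EuclideanSpace ℝ (Fin N) → ℝ}
    {M : ℝ} (hw : Integrable w) (hM : bvVariation w < ENNReal.ofReal M)
    (h : EuclideanSpace ℝ (Fin N)) :
    ∫⁻ x, ‖w (x + h) - w x‖ₑ ≤ ENNReal.ofReal (2 * N * M * ‖h‖) := by
  obtain ⟨l, hgrad, hl⟩ := exists_isDistribGradient_of_bvVariation_lt hM
  refine lintegral_enorm_le_of_forall_contDiff ((hw.comp_add_right h).sub hw) ?_
  intro φ hφ hφc hφ1
  have hφd : Continuous (fderiv ℝ φ) := hφ.continuous_fderiv (by simp)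
  obtain ⟨L, hL⟩ := (hφc.fderiv ℝ).exists_bound_of_continuous hφd
  -- The pairing with the translated difference is `J 1 - J 0`. Its derivative is a combination of
  -- gradient pairings, each of the `N` coordinates contributing at most `‖h‖ * (2 * M)`.
  set J : ℝ → ℝ := fun s => ∫ x, w x * φ (x - s • h) with hJ
  have hwφ : ∀ s : ℝ, Integrable fun x => w x * φ (x - s • h) := fun s =>
    hw.mul_bdd (c := 1) (by fun_prop) (Eventually.of_forall fun x => hφ1 _)
  have hderiv : ∀ s, HasDerivAt J (∫ x, w x * -(fderiv ℝ φ (x - s • h) h)) s := by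
    intro s
    refine (hasDerivAt_integral_of_dominated_loc_of_deriv_le (bound := fun x => ‖w x‖ * (L * ‖h‖))
      (F := fun (s : ℝ) x => w x * φ (x - s • h)) (F' := fun (s : ℝ) x => w x * -(fderiv ℝ φ (x - s • h) h))
      (s := univ) univ_mem (Eventually.of_forall fun s => (hwφ s).1) (hwφ s) ?_ ?_ ?_ ?_).2
    · exact hw.1.mul (((hφd.comp (continuous_id.sub continuous_const)).clm_apply
        continuous_const).neg.aestronglyMeasurable)
    · refine Eventually.of_forall fun x s _ => ?_
      rw [norm_mul, norm_neg]
      gcongr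
      exact (ContinuousLinearMap.le_opNorm _ _).trans (by gcongr; exact hL _)
    · exact hw.norm.mul_const _
    · refine Eventually.of_forall fun x s _ => ?_
      have h1 : HasDerivAt (fun s : ℝ => x - s • h) (-h) s := by
        simpa using ((hasDerivAt_id s).smul_const h).const_sub x
      have h2 := ((hφ.differentiable (by simp)) (x - s • h)).hasFDerivAt.comp_hasDerivAt s h1
      simpa using h2.const_mul (w x)
  have hbound : ∀ s : ℝ, ‖∫ x, w x * -(fderiv ℝ φ (x - s • h) h)‖ ≤ 2 * N * M * ‖h‖ := by
    intro s
    have hsum : ∀ x, w x * -(fderiv ℝ φ (x - s • h) h) =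
        ∑ i, -(h i) * (w x * fderiv ℝ (fun y => φ (y - s • h)) x (EuclideanSpace.single i 1)) := by
      intro x
      rw [fderiv_comp_sub]
      have hh : h = ∑ i, h i • EuclideanSpace.single i (1 : ℝ) := by
        ext j; simp [Finset.sum_apply, Pi.single_apply]
      rw [show fderiv ℝ φ (x - s • h) h = fderiv ℝ φ (x - s • h)
        (∑ i, h i • EuclideanSpace.single i (1 : ℝ)) from congrArg _ hh]
      simp only [map_sum, map_smul, smul_eq_mul, Finset.mul_sum, ← Finset.sum_neg_distrib]
      refine Finset.sum_congr rfl fun i _ => ?_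
      ring
    simp_rw [hsum]
    have hφs : ContDiff ℝ ∞ fun y => φ (y - s • h) := by fun_prop
    have hφsc : HasCompactSupport fun y => φ (y - s • h) := by
      simpa [Function.comp_def] using
        hφc.comp_homeomorph (Homeomorph.subRight (s • h))
    have hint : ∀ i, Integrable fun x =>
        w x * fderiv ℝ (fun y => φ (y - s • h)) x (EuclideanSpace.single i 1) := by
      intro i
      refine hw.mul_bdd (c := L) ?_ (Eventually.of_forall fun x => ?_)
      · exact ((hφs.continuous_fderiv (by simp)).clm_apply continuous_const).aestronglyMeasurable
      · rw [fderiv_comp_sub]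
        refine (ContinuousLinearMap.le_opNorm _ _).trans ?_
        simpa using hL _
    rw [integral_finsetSum _ fun i _ => (hint i).const_mul _]
    refine (norm_sum_le _ _).trans ?_
    have : ∀ i ∈ (Finset.univ : Finset (Fin N)), ‖∫ x, -(h i) *
        (w x * fderiv ℝ (fun y => φ (y - s • h)) x (EuclideanSpace.single i 1))‖ ≤
        ‖h‖ * (2 * M) := by
      intro i _
      rw [integral_const_mul, hgrad i _ hφs hφsc, norm_mul, norm_neg, norm_neg]
      gcongr
      · exact PiLp.norm_apply_le h i
      · exact hl i _ hφs.continuous hφsc fun x => hφ1 _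
    refine (Finset.sum_le_card_nsmul _ _ _ this).trans (le_of_eq ?_)
    simp; ring
  have hmv := (convex_univ (𝕜 := ℝ)).norm_image_sub_le_of_norm_hasDerivWithin_le
    (f := J) (fun s _ => (hderiv s).hasDerivWithinAt) (fun s _ => hbound s)
    (mem_univ (0 : ℝ)) (mem_univ (1 : ℝ))
  have hJ1 : ∫ x, (w (x + h) - w x) * φ x = J 1 - J 0 := by
    have h1 : ∫ x, w (x + h) * φ x = J 1 := by
      simpa [hJ] using integral_add_right_eq_self (μ := volume) (fun x => w x * φ (x - h)) h
    have h2 : Integrable fun x => w (x + h) * φ x :=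
      (hw.comp_add_right h).mul_bdd (c := 1) hφ.continuous.aestronglyMeasurable
        (Eventually.of_forall fun x => hφ1 _)
    have h3 : Integrable fun x => w x * φ x := by simpa using hwφ 0
    simp_rw [sub_mul]
    rw [integral_sub h2 h3, h1]
    simp [hJ]
  change ∫ x, (w (x + h) - w x) * φ x ≤ _
  rw [hJ1]
  simpa using (le_abs_self _).trans hmv

/-! ### Double integrals of differences -/

/-- Substituting `x = y + z` and applying Tonelli leaves translation differences in `L¹` weighted by
`m z`. -/
theorem lintegral_enorm_sub_mul_le {E : Type*} [NormedAddCommGroup E] [MeasurableSpace E]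
    [BorelSpace E] [SecondCountableTopology E] {μ : Measure E} [SFinite μ]
    [μ.IsAddRightInvariant] {w : E → ℝ} (hw : Measurable w) {m : E → ℝ≥0∞} (hm : Measurable m)
    {C : ℝ≥0∞} (h : ∀ z, ∫⁻ x, ‖w (x + z) - w x‖ₑ ∂μ ≤ C * min 1 ‖z‖ₑ) :
    ∫⁻ p, ‖w p.1 - w p.2‖ₑ * m (p.1 - p.2) ∂(μ.prod μ) ≤ C * ∫⁻ z, min 1 ‖z‖ₑ * m z ∂μ := by
  rw [lintegral_prod_symm' _ (by fun_prop)]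
  calc ∫⁻ y, ∫⁻ x, ‖w x - w y‖ₑ * m (x - y) ∂μ ∂μ
      = ∫⁻ y, ∫⁻ z, ‖w (z + y) - w y‖ₑ * m z ∂μ ∂μ := by
        refine lintegral_congr fun y => ?_
        rw [← lintegral_add_right_eq_self _ y]
        simp
    _ = ∫⁻ z, ∫⁻ y, ‖w (y + z) - w y‖ₑ * m z ∂μ ∂μ := by
        rw [lintegral_lintegral_swap (by fun_prop)]
        simp_rw [add_comm]
    _ ≤ ∫⁻ z, C * (min 1 ‖z‖ₑ * m z) ∂μ := by
        refine lintegral_mono fun z => ?_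
        rw [lintegral_mul_const _ (by fun_prop), ← mul_assoc]
        gcongr
        exact h z
    _ = C * ∫⁻ z, min 1 ‖z‖ₑ * m z ∂μ := lintegral_const_mul _ (by fun_prop)

/-- This gives test functions the same estimate as BV functions. Short shifts use the Lipschitz
bound on a unit neighbourhood of the support, long ones the triangle inequality. -/
theorem exists_lintegral_translate_sub_le_of_contDiff {E : Type*} [NormedAddCommGroup E]
    [NormedSpace ℝ E] [FiniteDimensional ℝ E] [MeasurableSpace E] [BorelSpace E]
    {μ : Measure E} [μ.IsAddHaarMeasure] {φ : E → ℝ} (hφ : ContDiff ℝ ∞ φ)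
    (hφc : HasCompactSupport φ) :
    ∃ C : ℝ≥0∞, C ≠ ⊤ ∧ ∀ z, ∫⁻ x, ‖φ (x + z) - φ x‖ₑ ∂μ ≤ C * min 1 ‖z‖ₑ := by
  obtain ⟨L, hL⟩ := hφ.lipschitzWith_of_hasCompactSupport hφc (by simp)
  set K := Metric.cthickening 1 (tsupport φ) with hK
  have hKc : IsCompact K := hφc.isCompact.cthickening
  have hφi : Integrable φ μ := hφ.continuous.integrable_of_hasCompactSupport hφc
  refine ⟨L * μ K + 2 * ∫⁻ x, ‖φ x‖ₑ ∂μ, ?_, fun z => ?_⟩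
  · exact ENNReal.add_ne_top.2 ⟨ENNReal.mul_ne_top (by simp) hKc.measure_lt_top.ne,
      ENNReal.mul_ne_top (by simp) hφi.2.ne⟩
  rcases le_total ‖z‖ₑ 1 with hz | hz
  · rw [min_eq_right hz, add_mul]
    refine le_add_right ?_
    have hz' : ‖z‖ ≤ 1 := by
      rw [← toReal_enorm]
      exact ENNReal.toReal_le_of_le_ofReal zero_le_one (by simpa using hz)
    calc ∫⁻ x, ‖φ (x + z) - φ x‖ₑ ∂μ ≤ ∫⁻ x, K.indicator (fun _ => L * ‖z‖ₑ) x ∂μ := by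
          refine lintegral_mono fun x => ?_
          by_cases hx : x ∈ K
          · rw [indicator_of_mem hx]
            have := hL.edist_le_mul (x + z) x
            simpa [edist_eq_enorm_sub] using this
          · have h1 : x ∉ tsupport φ := fun h => hx (Metric.self_subset_cthickening _ h)
            have h2 : x + z ∉ tsupport φ := fun h =>
              hx (Metric.mem_cthickening_of_dist_le x (x + z) 1 _ h (by simpa using hz'))
            simp [image_eq_zero_of_notMem_tsupport h1, image_eq_zero_of_notMem_tsupport h2]
      _ = L * μ K * ‖z‖ₑ := by
          rw [lintegral_indicator hKc.measurableSet, setLIntegral_const]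
          ring
  · rw [min_eq_left hz, mul_one]
    refine le_add_left ?_
    calc ∫⁻ x, ‖φ (x + z) - φ x‖ₑ ∂μ ≤ ∫⁻ x, (‖φ (x + z)‖ₑ + ‖φ x‖ₑ) ∂μ :=
          lintegral_mono fun x => enorm_sub_le
      _ = 2 * ∫⁻ x, ‖φ x‖ₑ ∂μ := by
          rw [lintegral_add_right _ hφ.continuous.measurable.enorm,
            lintegral_add_right_eq_self (fun x => ‖φ x‖ₑ) z, two_mul]

/-- Exchanging the variables and averaging the two expressions symmetrizes the integral. Both the
symmetry of the operator and its accretivity rest on this. -/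
theorem integral_mul_integral_of_antisymmetric {E : Type*} [MeasurableSpace E] {μ : Measure E}
    [SFinite μ] {D : E × E → ℝ} (hD : Integrable D (μ.prod μ))
    (hanti : ∀ᵐ p ∂(μ.prod μ), D p.swap = -D p) {f : E → ℝ} (hf : Measurable f) {b : ℝ}
    (hb : ∀ x, |f x| ≤ b) :
    ∫ x, f x * ∫ y, D (x, y) ∂μ ∂μ = 2⁻¹ * ∫ p, (f p.1 - f p.2) * D p ∂(μ.prod μ) := by
  have h1 : Integrable (fun p : E × E => f p.1 * D p) (μ.prod μ) :=
    hD.bdd_mul (c := b) (hf.comp measurable_fst).aestronglyMeasurable (Eventually.of_forall fun p => hb _)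
  have h2 : Integrable (fun p : E × E => f p.2 * D p) (μ.prod μ) :=
    hD.bdd_mul (c := b) (hf.comp measurable_snd).aestronglyMeasurable (Eventually.of_forall fun p => hb _)
  have h3 : ∫ p, f p.2 * D p ∂(μ.prod μ) = -∫ p, f p.1 * D p ∂(μ.prod μ) := by
    rw [← integral_neg, ← integral_prod_swap]
    refine integral_congr_ae ?_
    filter_upwards [hanti] with p hp
    simp [hp]
  have h4 : ∫ x, f x * ∫ y, D (x, y) ∂μ ∂μ = ∫ p, f p.1 * D p ∂(μ.prod μ) := by
    rw [integral_prod _ h1]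
    simp_rw [integral_const_mul]
  simp_rw [sub_mul]
  rw [integral_sub h1 h2, h3, h4]
  ring

/-! ### Integrability, symmetry and accretivity of the jump operator -/

/-- The integrand of the jump operator. -/
def jumpFlux {N : ℕ}
    (κ : ℝ → ℝ → EuclideanSpace ℝ (Fin N) → EuclideanSpace ℝ (Fin N) → ℝ)
    (v w : EuclideanSpace ℝ (Fin N) → ℝ)
    (p : EuclideanSpace ℝ (Fin N) × EuclideanSpace ℝ (Fin N)) : ℝ :=
  (w p.1 - w p.2) * κ (v p.1) (v p.2) p.1 p.2

namespace IsHomogeneousJumpKernel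

variable {N : ℕ} {κ : ℝ → ℝ → EuclideanSpace ℝ (Fin N) → EuclideanSpace ℝ (Fin N) → ℝ}

/-- Only the weighted majorant is known to be measurable; dividing by `min 1 ‖z‖` off the origin, a
null set as `1 ≤ N`, makes `m R ‖z‖` almost everywhere measurable. A Borel version then serves,
since subtraction pulls null sets back to null sets. -/
theorem exists_majorant (hκ : IsHomogeneousJumpKernel κ) (hN : 1 ≤ N) {R : ℝ} (hR : 0 < R) :
    ∃ m : EuclideanSpace ℝ (Fin N) → ℝ≥0∞, Measurable m ∧ ∫⁻ z, min 1 ‖z‖ₑ * m z ≠ ⊤ ∧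
      ∀ᵐ p : EuclideanSpace ℝ (Fin N) × EuclideanSpace ℝ (Fin N),
        ∀ a b : ℝ, |a| ≤ R → |b| ≤ R → ‖κ a b p.1 p.2‖ₑ ≤ m (p.1 - p.2) := by
  obtain ⟨m, hm⟩ := hκ.majorant
  obtain ⟨hm0, hle, hint, -⟩ := hm R hR
  have : Nonempty (Fin N) := ⟨⟨0, hN⟩⟩
  set m' : EuclideanSpace ℝ (Fin N) → ℝ≥0∞ := fun z => ENNReal.ofReal (m R ‖z‖) with hm'
  have hmeas : AEMeasurable m' := by
    have h1 : AEMeasurable fun z : EuclideanSpace ℝ (Fin N) =>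
        ENNReal.ofReal ((min 1 ‖z‖ * m R ‖z‖) / min 1 ‖z‖) :=
      (hint.1.aemeasurable.div (by fun_prop)).ennreal_ofReal
    refine h1.congr ?_
    have h0 : ∀ᵐ z : EuclideanSpace ℝ (Fin N), z ≠ 0 := by
      simp [ae_iff]
    filter_upwards [h0] with z hz
    have : min 1 ‖z‖ ≠ 0 := (lt_min one_pos (norm_pos_iff.2 hz)).ne'
    simp only [hm']
    rw [mul_div_cancel_left₀ _ this]
  refine ⟨hmeas.mk m', hmeas.measurable_mk, ?_, ?_⟩
  · have h1 : ∫⁻ z, min 1 ‖z‖ₑ * hmeas.mk m' z =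
        ∫⁻ z : EuclideanSpace ℝ (Fin N), ‖min 1 ‖z‖ * m R ‖z‖‖ₑ := by
      refine lintegral_congr_ae ?_
      filter_upwards [hmeas.ae_eq_mk] with z hz
      rw [← hz, enorm_mul, Real.enorm_of_nonneg (hm0 _ (norm_nonneg _)),
        Real.enorm_of_nonneg (by positivity), ENNReal.ofReal_min, ofReal_norm, ENNReal.ofReal_one]
    rw [h1]
    exact hint.2.ne
  · have hq := (quasiMeasurePreserving_sub (volume : Measure (EuclideanSpace ℝ (Fin N)))
      volume).ae hmeas.ae_eq_mk
    filter_upwards [hle, hκ.nonneg, hq] with p hp hp0 hpm a b ha hb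
    change m' (p.1 - p.2) = _ at hpm
    rw [← hpm, Real.enorm_of_nonneg (hp0 a b)]
    exact ENNReal.ofReal_le_ofReal (hp a (abs_le.1 ha) b (abs_le.1 hb))

theorem measurable_jumpFlux (hκ : IsHomogeneousJumpKernel κ)
    {v w : EuclideanSpace ℝ (Fin N) → ℝ} (hv : Measurable v) (hw : Measurable w) :
    Measurable (jumpFlux κ v w) :=
  ((hw.comp measurable_fst).sub (hw.comp measurable_snd)).mul
    (hκ.borel.comp (((hv.comp measurable_fst).prodMk (hv.comp measurable_snd)).prodMk
      measurable_id))

theorem lintegral_jumpFlux_le {R : ℝ} {m : EuclideanSpace ℝ (Fin N) → ℝ≥0∞} (hm : Measurable m)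
    (hκm : ∀ᵐ p : EuclideanSpace ℝ (Fin N) × EuclideanSpace ℝ (Fin N),
      ∀ a b : ℝ, |a| ≤ R → |b| ≤ R → ‖κ a b p.1 p.2‖ₑ ≤ m (p.1 - p.2))
    {v w : EuclideanSpace ℝ (Fin N) → ℝ} (hvR : ∀ x, |v x| ≤ R) (hw : Measurable w) {C : ℝ≥0∞}
    (h : ∀ z, ∫⁻ x, ‖w (x + z) - w x‖ₑ ≤ C * min 1 ‖z‖ₑ) :
    ∫⁻ p, ‖jumpFlux κ v w p‖ₑ ≤ C * ∫⁻ z, min 1 ‖z‖ₑ * m z := by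
  refine le_trans (lintegral_mono_ae ?_) (lintegral_enorm_sub_mul_le hw hm h)
  filter_upwards [hκm] with p hp
  rw [jumpFlux, enorm_mul]
  gcongr
  exact hp _ _ (hvR _) (hvR _)

theorem jumpFlux_swap (hκ : IsHomogeneousJumpKernel κ) (v w : EuclideanSpace ℝ (Fin N) → ℝ) :
    ∀ᵐ p, jumpFlux κ v w p.swap = -jumpFlux κ v w p := by
  filter_upwards [hκ.symmetric] with p hp
  simp only [jumpFlux, Prod.fst_swap, Prod.snd_swap]
  rw [hp]
  ring

/-- Both sides symmetrize to half the double integral of `(v(x) - v(y)) (φ(x) - φ(y)) κ(v(x), v(y);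
x, y)`. -/
theorem integral_mul_jumpOperator_comm (hκ : IsHomogeneousJumpKernel κ)
    {v φ : EuclideanSpace ℝ (Fin N) → ℝ} (hv : Measurable v) (hφ : Measurable φ) {b c : ℝ}
    (hvb : ∀ x, |v x| ≤ b) (hφc : ∀ x, |φ x| ≤ c)
    (hvv : Integrable (jumpFlux κ v v)) (hvφ : Integrable (jumpFlux κ v φ)) :
    ∫ x, v x * jumpOperator κ v φ x = ∫ x, φ x * jumpOperator κ v v x := by
  have h1 := integral_mul_integral_of_antisymmetric hvφ (hκ.jumpFlux_swap v φ) hv hvb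
  have h2 := integral_mul_integral_of_antisymmetric hvv (hκ.jumpFlux_swap v v) hφ hφc
  refine h1.trans (Eq.trans ?_ h2.symm)
  congr 2
  ext p
  simp only [jumpFlux]
  ring

/-- The kernel axiom covers `d ≤ c`. If `c ≤ d` and `b ≤ a`, the two sides have opposite signs; if
`c ≤ d` and `a ≤ b`, the axiom applies at the swapped point and symmetry brings it back. -/
theorem mul_le_mul_of_le_of_le (hκ : IsHomogeneousJumpKernel κ) :
    ∀ᵐ p : EuclideanSpace ℝ (Fin N) × EuclideanSpace ℝ (Fin N), ∀ a b c d : ℝ, c ≤ a → b ≤ d →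
      (c - d) * κ c d p.1 p.2 ≤ (a - b) * κ a b p.1 p.2 := by
  have hswap := (Measure.measurePreserving_swap (μ := (volume : Measure (EuclideanSpace ℝ (Fin N))))
    (ν := volume)).quasiMeasurePreserving.ae hκ.monotone
  filter_upwards [hκ.monotone, hκ.nonneg, hκ.symmetric, hswap] with p hmono h0 hsymm hmono'
    a b c d hca hbd
  rcases le_total d c with hdc | hcd
  · exact hmono a b c d hca hdc hbd
  rcases le_total b a with hba | hab
  · exact (mul_nonpos_of_nonpos_of_nonneg (sub_nonpos.2 hcd) (h0 c d)).trans
      (mul_nonneg (sub_nonneg.2 hba) (h0 a b))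
  · have h := hmono' d c b a hbd hab hca
    simp only [Prod.fst_swap, Prod.snd_swap] at h
    rw [← hsymm, ← hsymm] at h
    linarith

/-- The operator `v ↦ 𝓛_v v` is T-accretive in `L¹`. -/
theorem integral_indicator_mul_jumpOperator_sub_nonneg (hκ : IsHomogeneousJumpKernel κ)
    {u v : EuclideanSpace ℝ (Fin N) → ℝ} (hu : Measurable u) (hv : Measurable v)
    (huu : Integrable (jumpFlux κ u u)) (hvv : Integrable (jumpFlux κ v v)) :
    0 ≤ ∫ x, {x | v x < u x}.indicator 1 x *
      ∫ y, (jumpFlux κ u u (x, y) - jumpFlux κ v v (x, y)) := by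
  have hanti : ∀ᵐ p, (jumpFlux κ u u - jumpFlux κ v v) p.swap =
      -(jumpFlux κ u u - jumpFlux κ v v) p := by
    filter_upwards [hκ.jumpFlux_swap u u, hκ.jumpFlux_swap v v] with p h1 h2
    simp [h1, h2]
    ring
  have h := integral_mul_integral_of_antisymmetric (b := 1)
    (f := {x | v x < u x}.indicator (1 : EuclideanSpace ℝ (Fin N) → ℝ)) (huu.sub hvv) hanti
    (measurable_one.indicator (measurableSet_lt hv hu)) (by
      intro x
      by_cases hx : v x < u x <;> simp [indicator, hx])
  refine le_of_le_of_eq ?_ h.symm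
  refine mul_nonneg (by norm_num) (integral_nonneg_of_ae ?_)
  -- Only pairs with exactly one point in `{v < u}` contribute; there monotonicity gives the flux
  -- difference the sign of the indicator difference.
  filter_upwards [hκ.mul_le_mul_of_le_of_le] with p hp
  simp only [Pi.zero_apply, indicator, mem_ofPred_eq, Pi.one_apply, Pi.sub_apply, jumpFlux]
  split_ifs with h1 h2 h2
  · simp
  · have := hp _ _ _ _ h1.le (not_lt.1 h2)
    linarith
  · have := hp _ _ _ _ (not_lt.1 h1) h2.le
    linarith
  · simp

end IsHomogeneousJumpKernel

/-! ### Weak derivatives and positive parts in one variable -/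

/-- Primitives of test functions on `(0, ∞)` of integral zero are test functions. -/
theorem contDiff_primitive_of_integral_eq_zero {η : ℝ → ℝ} (hη : ContDiff ℝ ∞ η)
    (hηc : HasCompactSupport η) (hη0 : tsupport η ⊆ Ioi 0) (hint : ∫ r, η r = 0) :
    ∃ θ : ℝ → ℝ, ContDiff ℝ ∞ θ ∧ HasCompactSupport θ ∧ tsupport θ ⊆ Ioi 0 ∧ deriv θ = η := by
  obtain ⟨a, b, ha, hab⟩ : ∃ a b : ℝ, 0 < a ∧ tsupport η ⊆ Icc a b := by
    obtain ⟨b, hb⟩ := hηc.isCompact.bddAbove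
    rcases (tsupport η).eq_empty_or_nonempty with h | h
    · exact ⟨1, b, one_pos, by simp [h]⟩
    · obtain ⟨a, ha⟩ := hηc.isCompact.exists_isLeast h
      exact ⟨a, b, hη0 ha.1, fun x hx => ⟨ha.2 hx, hb hx⟩⟩
  have hηi : Integrable η := hη.continuous.integrable_of_hasCompactSupport hηc
  set θ : ℝ → ℝ := fun r => ∫ s in 0..r, η s with hθ
  have hder : ∀ r, HasDerivAt θ (η r) r := fun r =>
    intervalIntegral.integral_hasDerivAt_right hηi.intervalIntegrable
      (hη.continuous.stronglyMeasurableAtFilter _ _) hη.continuous.continuousAt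
  have hzero : ∀ r, r ∉ Icc a b → η r = 0 := fun r hr =>
    image_eq_zero_of_notMem_tsupport fun h => hr (hab h)
  have hvan : ∀ r, r ∉ Icc a b → θ r = 0 := by
    intro r hr
    rcases lt_or_ge r a with hra | har
    · refine intervalIntegral.integral_zero_ae (Eventually.of_forall fun s hs => hzero s fun h => ?_)
      rcases mem_uIoc.1 hs with h' | h' <;> linarith [h'.1, h'.2, h.1]
    · have hbr : b < r := lt_of_not_ge fun h => hr ⟨har, h⟩
      rw [hθ]
      simp only
      rw [intervalIntegral.integral_of_le (ha.le.trans har)]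
      refine Eq.trans (setIntegral_eq_integral_of_forall_compl_eq_zero fun s hs => hzero s fun h => hs ?_) hint
      exact ⟨ha.trans_le h.1, h.2.trans hbr.le⟩
  have hsupp : tsupport θ ⊆ Icc a b :=
    closure_minimal (fun r hr => by_contra fun h => hr (hvan r h)) isClosed_Icc
  have hderiv : deriv θ = η := funext fun r => (hder r).deriv
  refine ⟨θ, ?_, HasCompactSupport.intro isCompact_Icc hvan,
    hsupp.trans fun r hr => ha.trans_le hr.1, hderiv⟩
  rw [contDiff_infty_iff_deriv, hderiv]
  exact ⟨fun r => (hder r).differentiableAt, hη⟩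

/-- A continuous function on `[0, ∞)` whose weak derivative vanishes is constant. -/
theorem eqOn_const_of_integral_deriv_mul_eq_zero {H : ℝ → ℝ} (hH : ContinuousOn H (Ici 0))
    (h : ∀ θ : ℝ → ℝ, ContDiff ℝ ∞ θ → HasCompactSupport θ → tsupport θ ⊆ Ioi 0 →
      ∫ t in Ioi 0, deriv θ t * H t = 0) {t : ℝ} (ht : 0 ≤ t) : H t = H 0 := by
  let ρ₀ : ContDiffBump (2 : ℝ) := ⟨1 / 2, 1, by norm_num, by norm_num⟩
  set ρ := ρ₀.normed volume with hρ
  have hρs : ContDiff ℝ ∞ ρ := ρ₀.contDiff_normed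
  have hρc : HasCompactSupport ρ := ρ₀.hasCompactSupport_normed
  have hρ0 : tsupport ρ ⊆ Ioi 0 := by
    rw [hρ, ρ₀.tsupport_normed_eq]
    intro x hx
    have : |x - 2| ≤ 1 := by simpa [Real.dist_eq] using hx
    have := (abs_le.1 this).1
    simp only [mem_Ioi]
    linarith
  have hρ1 : ∫ r, ρ r = 1 := ρ₀.integral_normed
  have hHi : ∀ χ : ℝ → ℝ, Continuous χ → HasCompactSupport χ → tsupport χ ⊆ Ioi 0 →
      IntegrableOn (fun t => χ t * H t) (Ioi 0) := by
    intro χ hχ hχc hχ0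
    have h1 : IntegrableOn (fun t => χ t * H t) (tsupport χ) :=
      ((hχ.continuousOn.mul (hH.mono (hχ0.trans Ioi_subset_Ici_self))).integrableOn_compact hχc)
    have h2 : Integrable (fun t => χ t * H t) :=
      (integrableOn_iff_integrable_of_support_subset (fun x hx =>
        subset_tsupport _ fun h => hx (by simp [h]))).1 h1
    exact h2.integrableOn
  set c := ∫ t in Ioi 0, ρ t * H t with hc
  have key : ∀ χ : ℝ → ℝ, ContDiff ℝ ∞ χ → HasCompactSupport χ → tsupport χ ⊆ Ioi 0 →
      ∫ t, χ t • (H t - c) = 0 := by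
    intro χ hχ hχc hχ0
    -- Subtracting `I * ρ` makes the integral vanish, so the difference is the derivative of a test
    -- function; hence `H` equals its `ρ`-weighted mean `c` in the weak sense.
    set I := ∫ r, χ r with hI
    have hχi : Integrable χ := hχ.continuous.integrable_of_hasCompactSupport hχc
    have hρi : Integrable ρ := hρs.continuous.integrable_of_hasCompactSupport hρc
    have hsub : tsupport (fun r => χ r - I * ρ r) ⊆ tsupport χ ∪ tsupport ρ := by
      refine closure_minimal (fun r hr => ?_)
        ((isClosed_tsupport _).union (isClosed_tsupport _))
      by_contra hcon
      rw [mem_union, not_or] at hcon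
      exact hr (by simp [image_eq_zero_of_notMem_tsupport hcon.1,
        image_eq_zero_of_notMem_tsupport hcon.2])
    obtain ⟨θ, hθ, hθc, hθ0, hθd⟩ := contDiff_primitive_of_integral_eq_zero
      (η := fun r => χ r - I * ρ r) (hχ.sub (contDiff_const.mul hρs))
      (hχc.sub (hρc.mul_left (f := fun _ => I)))
      (hsub.trans (union_subset hχ0 hρ0))
      (by rw [integral_sub hχi (hρi.const_mul _), integral_const_mul, hρ1, mul_one, sub_self])
    have h1 := h θ hθ hθc hθ0
    rw [hθd] at h1
    simp_rw [sub_mul, mul_assoc] at h1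
    rw [integral_sub (hHi χ hχ.continuous hχc hχ0)
      ((hHi ρ hρs.continuous hρc hρ0).const_mul I), integral_const_mul, ← hc] at h1
    have h2 : ∫ t, χ t • (H t - c) = ∫ t in Ioi 0, (χ t * H t - χ t * c) := by
      rw [setIntegral_eq_integral_of_forall_compl_eq_zero]
      · simp [mul_sub]
      · intro x hx
        have : χ x = 0 := image_eq_zero_of_notMem_tsupport fun h => hx (hχ0 h)
        simp [this]
    have h3 : ∫ t in Ioi 0, χ t = I :=
      setIntegral_eq_integral_of_forall_compl_eq_zero fun x hx =>
        image_eq_zero_of_notMem_tsupport fun h => hx (hχ0 h)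
    rw [h2, integral_sub (hHi χ hχ.continuous hχc hχ0) (hχi.integrableOn.mul_const c),
      integral_mul_const, h3]
    exact h1
  have hcont : ContinuousOn (fun t => H t - c) (Ici 0) := hH.sub continuousOn_const
  have hae : ∀ᵐ t, t ∈ Ioi (0 : ℝ) → H t - c = 0 :=
    isOpen_Ioi.ae_eq_zero_of_integral_contDiff_smul_eq_zero
      ((hcont.mono Ioi_subset_Ici_self).locallyIntegrableOn measurableSet_Ioi) key
  have hIoi : EqOn H (fun _ => c) (Ioi 0) := by
    refine Measure.eqOn_open_of_ae_eq (μ := volume) ?_ isOpen_Ioi (hH.mono Ioi_subset_Ici_self)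
      continuousOn_const
    refine (ae_restrict_iff' measurableSet_Ioi).2 ?_
    filter_upwards [hae] with t ht h using sub_eq_zero.1 (ht h)
  have hIci : EqOn H (fun _ => c) (Ici 0) :=
    hIoi.of_subset_closure hH continuousOn_const Ioi_subset_Ici_self (by simp)
  exact (hIci ht).trans (hIci (self_mem_Ici (a := (0 : ℝ)))).symm

/-- A continuous function on `[0, ∞)` with bounded weak derivative `-B` is the primitive of
`-B`. -/
theorem eq_sub_integral_of_weak_deriv {A B : ℝ → ℝ} (hA : ContinuousOn A (Ici 0))
    (hB : Measurable B) {b : ℝ} (hb : ∀ t, |B t| ≤ b)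
    (h : ∀ θ : ℝ → ℝ, ContDiff ℝ ∞ θ → HasCompactSupport θ → tsupport θ ⊆ Ioi 0 →
      ∫ t in Ioi 0, (deriv θ t * A t - θ t * B t) = 0) {t : ℝ} (ht : 0 ≤ t) :
    A t = A 0 - ∫ s in 0..t, B s := by
  have hBi : ∀ r s : ℝ, IntervalIntegrable B volume r s := fun r s =>
    (intervalIntegrable_const (c := b)).mono_fun hB.aestronglyMeasurable
      (Eventually.of_forall fun t => (hb t).trans (le_abs_self b))
  set P : ℝ → ℝ := fun t => ∫ s in 0..t, B s with hP
  have hPc : Continuous P := intervalIntegral.continuous_primitive hBi 0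
  have key := eqOn_const_of_integral_deriv_mul_eq_zero (H := fun t => A t + P t)
    (hA.add hPc.continuousOn) ?_ ht
  · have h0 : P 0 = 0 := intervalIntegral.integral_same
    change A t = A 0 - P t
    linarith
  intro θ hθ hθc hθ0
  have hθd : Continuous (deriv θ) := hθ.continuous_deriv (by simp)
  have hθdc : HasCompactSupport (deriv θ) := hθc.deriv
  have hθds : tsupport (deriv θ) ⊆ Ioi 0 := (tsupport_deriv_subset).trans hθ0
  have hi1 : IntegrableOn (fun t => deriv θ t * A t) (Ioi 0) := by
    have h1 : IntegrableOn (fun t => deriv θ t * A t) (tsupport (deriv θ)) :=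
      (hθd.continuousOn.mul (hA.mono (hθds.trans Ioi_subset_Ici_self))).integrableOn_compact hθdc
    exact ((integrableOn_iff_integrable_of_support_subset (fun x hx =>
        subset_tsupport _ fun h => hx (by simp [h]))).1 h1).integrableOn
  have hi2 : Integrable (fun t => θ t * B t) :=
    (hθ.continuous.integrable_of_hasCompactSupport hθc).mul_bdd (c := b)
      hB.aestronglyMeasurable (Eventually.of_forall hb)
  have hi3 : Integrable (fun t => deriv θ t * P t) :=
    (hθd.mul hPc).integrable_of_hasCompactSupport hθdc.mul_right
  have h1 := h θ hθ hθc hθ0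
  rw [integral_sub hi1 hi2.integrableOn] at h1
  obtain ⟨b', hb'⟩ := hθc.isCompact.bddAbove
  -- `T` lies strictly beyond the support of `θ`, so integration by parts on `[0, T]` has no
  -- boundary terms.
  set T := max b' 0 + 1 with hT
  have hT0 : 0 ≤ T := by positivity
  have hvan : ∀ t, t ∉ Ioc 0 T → θ t = 0 ∧ deriv θ t = 0 := by
    intro t ht
    have : t ∉ tsupport θ := fun h => ht ⟨hθ0 h, (hb' h).trans (by
      rw [hT]; linarith [le_max_left b' 0])⟩
    exact ⟨image_eq_zero_of_notMem_tsupport this,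
      image_eq_zero_of_notMem_tsupport fun h => this (tsupport_deriv_subset h)⟩
  have hT' : θ T = 0 := image_eq_zero_of_notMem_tsupport fun h => by
    have := hb' h
    linarith [le_max_left b' 0]
  have h00 : θ 0 = 0 := (hvan 0 (by simp)).1
  have hPac : AbsolutelyContinuousOnInterval P 0 T :=
    (hBi 0 T).absolutelyContinuousOnInterval_intervalIntegral (by simp)
  have hθac : AbsolutelyContinuousOnInterval θ 0 T :=
    (hθ.of_le (by simp)).contDiffOn.absolutelyContinuousOnInterval
  have hparts := hθac.integral_deriv_mul_eq_sub hPac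
  have hPd : ∀ᵐ t, t ∈ uIcc 0 T → HasDerivAt P (B t) t :=
    (hBi 0 T).ae_hasDerivAt_integral.mono fun t ht h => ht h 0 (by simp)
  have hEq : ∫ t in 0..T, (deriv θ t * P t + θ t * deriv P t) =
      ∫ t in 0..T, (deriv θ t * P t + θ t * B t) := by
    refine intervalIntegral.integral_congr_ae ?_
    filter_upwards [hPd] with t ht h
    rw [(ht (uIoc_subset_uIcc h)).deriv]
  rw [hEq, hT', h00, zero_mul, zero_mul, sub_zero, intervalIntegral.integral_of_le hT0,
    integral_add hi3.integrableOn hi2.integrableOn] at hparts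
  have hs : ∀ g : ℝ → ℝ, (∀ t, t ∉ Ioc 0 T → g t = 0) →
      ∫ t in Ioc 0 T, g t = ∫ t in Ioi 0, g t := by
    intro g hg
    rw [setIntegral_eq_integral_of_forall_compl_eq_zero hg,
      setIntegral_eq_integral_of_forall_compl_eq_zero (s := Ioi 0) fun t ht =>
        hg t fun h => ht h.1]
  rw [hs _ fun t ht => by simp [(hvan t ht).2], hs _ fun t ht => by simp [(hvan t ht).1]] at hparts
  simp_rw [mul_add]
  rw [integral_add hi1 hi3.integrableOn]
  linarith

theorem AbsolutelyContinuousOnInterval.posPart {f : ℝ → ℝ} {a b : ℝ}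
    (hf : AbsolutelyContinuousOnInterval f a b) :
    AbsolutelyContinuousOnInterval (fun t => max (f t) 0) a b := by
  rw [absolutelyContinuousOnInterval_iff] at hf ⊢
  intro ε hε
  obtain ⟨δ, hδ, h⟩ := hf ε hε
  refine ⟨δ, hδ, fun I hI hlt => lt_of_le_of_lt (Finset.sum_le_sum fun i _ => ?_) (h I hI hlt)⟩
  exact abs_max_sub_max_le_abs _ _ _

/-- The chain rule for the positive part of a primitive. -/
theorem max_zero_sub_integral {g : ℝ → ℝ} {T : ℝ} (hg : IntervalIntegrable g volume 0 T) (c : ℝ) :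
    max (c - ∫ s in 0..T, g s) 0 =
      max c 0 - ∫ t in 0..T, {t | 0 < c - ∫ s in 0..t, g s}.indicator g t := by
  set W : ℝ → ℝ := fun t => c - ∫ s in 0..t, g s with hW
  have hWac : AbsolutelyContinuousOnInterval W 0 T :=
    (contDiff_const.contDiffOn.absolutelyContinuousOnInterval).sub
      (hg.absolutelyContinuousOnInterval_intervalIntegral (by simp))
  have h1 := hWac.posPart.integral_deriv_eq_sub
  have h2 : ∫ t in 0..T, deriv (fun t => max (W t) 0) t =
      ∫ t in 0..T, -{t | 0 < W t}.indicator g t := by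
    refine intervalIntegral.integral_congr_ae ?_
    filter_upwards [hg.ae_hasDerivAt_integral, hWac.posPart.ae_differentiableAt] with t ht1 ht2 ht
    have hd : HasDerivAt W (-g t) t := by
      simpa using (ht1 (uIoc_subset_uIcc ht) 0 (by simp)).const_sub c
    have hd' := ht2 (uIoc_subset_uIcc ht)
    rcases lt_trichotomy (W t) 0 with h | h | h
    · have he : (fun t => max (W t) 0) =ᶠ[𝓝 t] fun _ => 0 := by
        filter_upwards [hd.continuousAt.eventually_lt_const h] with s hs
        exact max_eq_right hs.le
      rw [he.deriv_eq, indicator_of_notMem (by simpa using h.le)]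
      simp
    -- At a zero of `W` the positive part is minimal, so its derivative vanishes wherever it exists,
    -- whatever the value of `g t`.
    · have hmin : IsLocalMin (fun t => max (W t) 0) t :=
        Eventually.of_forall fun s => by simp [h]
      rw [hmin.deriv_eq_zero, indicator_of_notMem (by simp [h])]
      simp
    · have he : (fun t => max (W t) 0) =ᶠ[𝓝 t] W := by
        filter_upwards [hd.continuousAt.eventually_const_lt h] with s hs
        exact max_eq_left hs.le
      rw [he.deriv_eq, hd.deriv, indicator_of_mem (by simpa using h)]
  rw [h2, intervalIntegral.integral_neg] at h1
  have h0 : W 0 = c := by simp [hW]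
  simp only [h0] at h1
  change max (W T) 0 = _
  linarith

/-! ### Regularity of strong solutions -/

theorem tendsto_integral_mul_of_tendsto_eLpNorm {E : Type*} [TopologicalSpace E]
    [T2Space E] [MeasurableSpace E] [BorelSpace E] [SecondCountableTopology E] {μ : Measure E}
    {ι : Type*} {l : Filter ι} {f : ι → E → ℝ} {g φ : E → ℝ} (hφ : Continuous φ)
    (hφc : HasCompactSupport φ) (hf : ∀ᶠ s in l, LocallyIntegrable (f s) μ)
    (hg : LocallyIntegrable g μ)
    (h : Tendsto (fun s => eLpNorm (fun x => f s x - g x) 1 (μ.restrict (tsupport φ))) l (𝓝 0)) :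
    Tendsto (fun s => ∫ x, f s x * φ x ∂μ) l (𝓝 (∫ x, g x * φ x ∂μ)) := by
  obtain ⟨c, hc⟩ := hφc.exists_bound_of_continuous hφ
  rw [tendsto_iff_edist_tendsto_0]
  have h0 : Tendsto (fun s => ENNReal.ofReal c *
      eLpNorm (fun x => f s x - g x) 1 (μ.restrict (tsupport φ))) l (𝓝 0) := by
    simpa using ENNReal.Tendsto.const_mul h (Or.inr ENNReal.ofReal_ne_top)
  refine tendsto_of_tendsto_of_tendsto_of_le_of_le' tendsto_const_nhds h0
    (Eventually.of_forall fun _ => zero_le) ?_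
  have hgi : Integrable (fun x => g x * φ x) μ := by
    simpa [mul_comm] using hg.integrable_smul_left_of_hasCompactSupport hφ hφc
  filter_upwards [hf] with s hs
  have hfi : Integrable (fun x => f s x * φ x) μ := by
    simpa [mul_comm] using hs.integrable_smul_left_of_hasCompactSupport hφ hφc
  rw [edist_eq_enorm_sub, ← integral_sub hfi hgi, eLpNorm_one_eq_lintegral_enorm,
    ← lintegral_const_mul' _ _ ENNReal.ofReal_ne_top]
  refine (enorm_integral_le_lintegral_enorm _).trans ?_
  rw [← lintegral_indicator (isClosed_tsupport φ).measurableSet]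
  refine lintegral_mono fun x => ?_
  by_cases hx : x ∈ tsupport φ
  · rw [indicator_of_mem hx, ← sub_mul, enorm_mul, mul_comm]
    gcongr
    rw [← ofReal_norm]
    exact ENNReal.ofReal_le_ofReal (hc x)
  · simp [hx, image_eq_zero_of_notMem_tsupport hx]

/-- Short shifts are controlled by the variation, long ones by the term `2 ‖w‖₁` of the norm.
Passing to `C + 1` supplies the strict inequality needed for the variation. -/
theorem lintegral_translate_sub_le_of_bvNorm_le {N : ℕ} {w : EuclideanSpace ℝ (Fin N) → ℝ}
    (hw : MemBV w) {C : ℝ≥0} (hC : bvNorm w ≤ C) (z : EuclideanSpace ℝ (Fin N)) :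
    ∫⁻ x, ‖w (x + z) - w x‖ₑ ≤ ((2 * N + 1) * (C + 1) : ℝ≥0) * min 1 ‖z‖ₑ := by
  have hwi : Integrable w := memLp_one_iff_integrable.1 hw.1
  rcases le_total ‖z‖ₑ 1 with hz | hz
  · rw [min_eq_right hz]
    have hvar : bvVariation w < ENNReal.ofReal (C + 1) := by
      refine lt_of_le_of_lt ((le_add_left le_rfl).trans hC) ?_
      rw [← ENNReal.ofReal_coe_nnreal]
      exact (ENNReal.ofReal_lt_ofReal_iff (by positivity)).2 (by linarith)
    refine (lintegral_translate_sub_le_of_bvVariation_lt hwi hvar z).trans ?_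
    rw [← ofReal_norm, ← ENNReal.ofReal_coe_nnreal, ← ENNReal.ofReal_mul (by positivity)]
    refine ENNReal.ofReal_le_ofReal ?_
    push_cast
    gcongr
    linarith
  · rw [min_eq_left hz, mul_one]
    calc ∫⁻ x, ‖w (x + z) - w x‖ₑ ≤ ∫⁻ x, (‖w (x + z)‖ₑ + ‖w x‖ₑ) :=
          lintegral_mono fun x => enorm_sub_le
      _ = 2 * ∫⁻ x, ‖w x‖ₑ := by
          rw [lintegral_add_right' _ hwi.1.enorm,
            lintegral_add_right_eq_self (fun x => ‖w x‖ₑ) z, two_mul]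
      _ ≤ C := by
          rw [← eLpNorm_one_eq_lintegral_enorm]
          exact (le_add_right le_rfl).trans hC
      _ ≤ _ := by
          rw [ENNReal.coe_le_coe]
          calc C ≤ 1 * (C + 1) := by rw [one_mul]; exact le_add_right le_rfl
            _ ≤ _ := by gcongr; exact le_add_left le_rfl

namespace IsStrongSolution

variable {N : ℕ} {κ : ℝ → ℝ → EuclideanSpace ℝ (Fin N) → EuclideanSpace ℝ (Fin N) → ℝ}
  {u₀ : EuclideanSpace ℝ (Fin N) → ℝ} {u : ℝ → EuclideanSpace ℝ (Fin N) → ℝ}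

/-- The bounds on `u` hold only at almost every time, and `u` itself need not be jointly measurable.
Zeroing a measurable version on a null set of bad times and clipping it to `[-R, R]` makes every
bound hold at all times. -/
theorem exists_measurable_representative (hu : IsStrongSolution κ u₀ u) :
    ∃ (U : ℝ → EuclideanSpace ℝ (Fin N) → ℝ) (R : ℝ) (C : ℝ≥0), 0 < R ∧
      Measurable (fun p : ℝ × EuclideanSpace ℝ (Fin N) => U p.1 p.2) ∧
      (∀ t x, |U t x| ≤ R) ∧ (∀ t, Integrable (U t)) ∧
      (∀ t z, ∫⁻ x, ‖U t (x + z) - U t x‖ₑ ≤ C * min 1 ‖z‖ₑ) ∧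
      ∀ᵐ t ∂volume.restrict (Ioi (0 : ℝ)), u t =ᵐ[volume] U t := by
  classical
  obtain ⟨C, hC⟩ := hu.bounded_bv
  set μ := volume.restrict (Ici (0 : ℝ)) with hμ
  set U₀ := hu.memLp_top.1.mk _ with hU₀
  have hU₀m : Measurable U₀ := hu.memLp_top.1.stronglyMeasurable_mk.measurable
  have hae : ∀ᵐ t ∂μ, ∀ᵐ x, u t x = U₀ (t, x) :=
    Measure.ae_ae_of_ae_prod hu.memLp_top.1.ae_eq_mk
  have hgood : ∀ᵐ t ∂μ, (∀ᵐ x, u t x = U₀ (t, x)) ∧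
      MemBV (u t) ∧ MemLp (u t) ∞ volume ∧ bvNorm (u t) + eLpNorm (u t) ∞ volume ≤ C := by
    filter_upwards [hae, hC] with t h1 h2 using ⟨h1, h2⟩
  set S := toMeasurable μ {t | ¬ ((∀ᵐ x, u t x = U₀ (t, x)) ∧
      MemBV (u t) ∧ MemLp (u t) ∞ volume ∧ bvNorm (u t) + eLpNorm (u t) ∞ volume ≤ C)} with hS
  have hSm : MeasurableSet S := measurableSet_toMeasurable _ _
  have hS0 : μ S = 0 := by rw [hS, measure_toMeasurable]; exact hgood
  set R : ℝ := C + 1 with hR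
  have hR0 : 0 < R := by positivity
  set U : ℝ → EuclideanSpace ℝ (Fin N) → ℝ := fun t x =>
    if t ∈ S then 0 else max (-R) (min R (U₀ (t, x))) with hU
  have hUS : ∀ t ∈ S, U t = 0 := fun t ht => by ext x; simp [hU, ht]
  have hUu : ∀ t, t ∉ S → MemBV (u t) ∧ bvNorm (u t) ≤ C ∧ u t =ᵐ[volume] U t := by
    intro t ht
    have hg := not_not.1 fun h => ht (subset_toMeasurable _ _ h)
    obtain ⟨h1, h2, h3, h4⟩ := hg
    refine ⟨h2, (le_add_right le_rfl).trans h4, ?_⟩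
    filter_upwards [h1, ae_le_eLpNormEssSup (f := u t) (μ := volume)] with x hx hxC
    have hle : ‖u t x‖ₑ ≤ C := by
      refine hxC.trans ?_
      rw [← eLpNorm_exponent_top]
      exact (le_add_left le_rfl).trans h4
    have habs : |u t x| ≤ R := by
      rw [← Real.norm_eq_abs, ← coe_nnnorm]
      have : ‖u t x‖₊ ≤ C := by exact_mod_cast hle
      have : (‖u t x‖₊ : ℝ) ≤ C := by exact_mod_cast this
      linarith
    rw [hx] at habs
    simp only [hU, if_neg ht]
    rw [min_eq_right (abs_le.1 habs).2, max_eq_right (abs_le.1 habs).1, hx]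
  refine ⟨U, R, (2 * N + 1) * (C + 1), hR0, ?_, ?_, ?_, ?_, ?_⟩
  · exact Measurable.ite (measurable_fst hSm) measurable_const
      (measurable_const.max (measurable_const.min hU₀m))
  · intro t x
    by_cases ht : t ∈ S
    · simp [hU, ht, hR0.le]
    · simp only [hU, if_neg ht, abs_le]
      exact ⟨le_max_left _ _, max_le (by linarith) (min_le_left _ _)⟩
  · intro t
    by_cases ht : t ∈ S
    · rw [hUS t ht]; exact integrable_zero _ _ _
    · exact (memLp_one_iff_integrable.1 (hUu t ht).1.1).congr (hUu t ht).2.2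
  · intro t z
    by_cases ht : t ∈ S
    · simp [hUS t ht]
    · obtain ⟨h1, h2, h3⟩ := hUu t ht
      refine le_trans (le_of_eq (lintegral_congr_ae ?_))
        (lintegral_translate_sub_le_of_bvNorm_le h1 h2 z)
      filter_upwards [h3, (measurePreserving_add_right volume z).quasiMeasurePreserving.ae h3]
        with x hx hxz
      rw [hx, hxz]
  · have hle : volume.restrict (Ioi (0 : ℝ)) ≤ μ := Measure.restrict_mono Ioi_subset_Ici_self le_rfl
    refine ae_mono hle ?_
    filter_upwards [measure_eq_zero_iff_ae_notMem.1 hS0] with t ht using (hUu t ht).2.2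

theorem continuousOn_integral_mul (hu : IsStrongSolution κ u₀ u) {φ : EuclideanSpace ℝ (Fin N) → ℝ}
    (hφ : Continuous φ) (hφc : HasCompactSupport φ) :
    ContinuousOn (fun t => ∫ x, u t x * φ x) (Ici 0) := by
  intro t ht
  refine tendsto_integral_mul_of_tendsto_eLpNorm hφ hφc ?_ (hu.locallyIntegrable t ht)
    (hu.continuous_L1loc t ht _ hφc.isCompact)
  filter_upwards [self_mem_nhdsWithin] with s hs using hu.locallyIntegrable s hs

/-- The initial condition concerns only the limit from positive times; continuity at zero identifies
that limit with the value `u 0`. -/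
theorem integral_zero_mul (hu : IsStrongSolution κ u₀ u) (hu₀ : Integrable u₀)
    {φ : EuclideanSpace ℝ (Fin N) → ℝ} (hφ : Continuous φ) (hφc : HasCompactSupport φ) :
    ∫ x, u 0 x * φ x = ∫ x, u₀ x * φ x := by
  have h1 : Tendsto (fun t => ∫ x, u t x * φ x) (𝓝[>] 0) (𝓝 (∫ x, u 0 x * φ x)) :=
    ((hu.continuousOn_integral_mul hφ hφc) 0 self_mem_Ici).mono_left
      (nhdsWithin_mono _ Ioi_subset_Ici_self)
  refine tendsto_nhds_unique h1 (tendsto_integral_mul_of_tendsto_eLpNorm hφ hφc ?_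
    hu₀.locallyIntegrable (hu.initial _ hφc.isCompact))
  filter_upwards [self_mem_nhdsWithin] with s hs using hu.locallyIntegrable s (le_of_lt hs)

end IsStrongSolution

namespace IsHomogeneousJumpKernel

variable {N : ℕ} {κ : ℝ → ℝ → EuclideanSpace ℝ (Fin N) → EuclideanSpace ℝ (Fin N) → ℝ}

theorem measurable_jumpOperator (hκ : IsHomogeneousJumpKernel κ)
    {U : ℝ → EuclideanSpace ℝ (Fin N) → ℝ}
    (hU : Measurable fun p : ℝ × EuclideanSpace ℝ (Fin N) => U p.1 p.2) :
    Measurable fun p : ℝ × EuclideanSpace ℝ (Fin N) => jumpOperator κ (U p.1) (U p.1) p.2 := by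
  have h1 : Measurable fun q : (ℝ × EuclideanSpace ℝ (Fin N)) × EuclideanSpace ℝ (Fin N) =>
      U q.1.1 q.1.2 := hU.comp measurable_fst
  have h2 : Measurable fun q : (ℝ × EuclideanSpace ℝ (Fin N)) × EuclideanSpace ℝ (Fin N) =>
      U q.1.1 q.2 := hU.comp ((measurable_fst.comp measurable_fst).prodMk measurable_snd)
  have h3 : Measurable fun q : (ℝ × EuclideanSpace ℝ (Fin N)) × EuclideanSpace ℝ (Fin N) =>
      (U q.1.1 q.1.2 - U q.1.1 q.2) * κ (U q.1.1 q.1.2) (U q.1.1 q.2) q.1.2 q.2 :=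
    (h1.sub h2).mul (hκ.borel.comp ((h1.prodMk h2).prodMk
      ((measurable_snd.comp measurable_fst).prodMk measurable_snd)))
  exact (h3.stronglyMeasurable.integral_prod_right (ν := volume)).measurable

end IsHomogeneousJumpKernel

theorem lintegral_enorm_jumpOperator_le {N : ℕ}
    {κ : ℝ → ℝ → EuclideanSpace ℝ (Fin N) → EuclideanSpace ℝ (Fin N) → ℝ}
    {v w : EuclideanSpace ℝ (Fin N) → ℝ} (h : Measurable (jumpFlux κ v w)) :
    ∫⁻ x, ‖jumpOperator κ v w x‖ₑ ≤ ∫⁻ p, ‖jumpFlux κ v w p‖ₑ := by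
  rw [Measure.volume_eq_prod, lintegral_prod _ h.enorm.aemeasurable]
  exact lintegral_mono fun x => enorm_integral_le_lintegral_enorm _

theorem integrable_jumpOperator_prod {N : ℕ}
    {κ : ℝ → ℝ → EuclideanSpace ℝ (Fin N) → EuclideanSpace ℝ (Fin N) → ℝ}
    (hκ : IsHomogeneousJumpKernel κ)
    {U : ℝ → EuclideanSpace ℝ (Fin N) → ℝ}
    (hU : Measurable fun p : ℝ × EuclideanSpace ℝ (Fin N) => U p.1 p.2) {K : ℝ≥0∞} (hK : K ≠ ⊤)
    (h : ∀ t, ∫⁻ p, ‖jumpFlux κ (U t) (U t) p‖ₑ ≤ K) (t : ℝ) :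
    Integrable (fun p : ℝ × EuclideanSpace ℝ (Fin N) => jumpOperator κ (U p.1) (U p.1) p.2)
      ((volume.restrict (Ioc 0 t)).prod volume) := by
  have hm := hκ.measurable_jumpOperator hU
  refine ⟨hm.aestronglyMeasurable, ?_⟩
  rw [hasFiniteIntegral_iff_enorm, lintegral_prod _ hm.enorm.aemeasurable]
  calc ∫⁻ s in Ioc 0 t, ∫⁻ x, ‖jumpOperator κ (U s) (U s) x‖ₑ ≤ ∫⁻ s in Ioc 0 t, K :=
        lintegral_mono fun s => (lintegral_enorm_jumpOperator_le (hκ.measurable_jumpFlux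
          (hU.comp measurable_prodMk_left) (hU.comp measurable_prodMk_left))).trans (h s)
    _ < ⊤ := by
        rw [setLIntegral_const]
        exact ENNReal.mul_lt_top hK.lt_top (by simp)

theorem jumpOperator_const_mul_ae_eq {N : ℕ}
    {κ : ℝ → ℝ → EuclideanSpace ℝ (Fin N) → EuclideanSpace ℝ (Fin N) → ℝ}
    {v v' : EuclideanSpace ℝ (Fin N) → ℝ} (h : v =ᵐ[volume] v') (c : ℝ)
    (w : EuclideanSpace ℝ (Fin N) → ℝ) :
    ∀ᵐ x, jumpOperator κ v (fun z => c * w z) x = c * jumpOperator κ v' w x := by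
  filter_upwards [h] with x hx
  rw [jumpOperator, jumpOperator, ← integral_const_mul]
  refine integral_congr_ae ?_
  filter_upwards [h] with y hy
  rw [hx, hy]
  ring

/-! ### The integrated equation -/

/-- The equation tested with products of functions of time and space. -/
theorem IsStrongSolution.integral_deriv_mul_sub_eq_zero {N : ℕ}
    {κ : ℝ → ℝ → EuclideanSpace ℝ (Fin N) → EuclideanSpace ℝ (Fin N) → ℝ}
    {u₀ : EuclideanSpace ℝ (Fin N) → ℝ} {u : ℝ → EuclideanSpace ℝ (Fin N) → ℝ}
    (hκ : IsHomogeneousJumpKernel κ) (hu : IsStrongSolution κ u₀ u)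
    {U : ℝ → EuclideanSpace ℝ (Fin N) → ℝ} {R : ℝ}
    (hUm : ∀ t, Measurable (U t)) (hUR : ∀ t x, |U t x| ≤ R) (hUi : ∀ t, Integrable (U t))
    (huU : ∀ᵐ t ∂volume.restrict (Ioi (0 : ℝ)), u t =ᵐ[volume] U t)
    (hUU : ∀ t, Integrable (jumpFlux κ (U t) (U t)))
    {φ : EuclideanSpace ℝ (Fin N) → ℝ} (hφ : ContDiff ℝ ∞ φ) (hφc : HasCompactSupport φ)
    (hUφ : ∀ t, Integrable (jumpFlux κ (U t) φ))
    {θ : ℝ → ℝ} (hθ : ContDiff ℝ ∞ θ) (hθc : HasCompactSupport θ) (hθ0 : tsupport θ ⊆ Ioi 0) :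
    ∫ t in Ioi 0, (deriv θ t * ∫ x, u t x * φ x) -
      θ t * ∫ x, φ x * jumpOperator κ (U t) (U t) x = 0 := by
  obtain ⟨c, hc⟩ := hφc.exists_bound_of_continuous hφ.continuous
  have hψ : ContDiff ℝ ∞ fun p : ℝ × EuclideanSpace ℝ (Fin N) => θ p.1 * φ p.2 :=
    (hθ.comp contDiff_fst).mul (hφ.comp contDiff_snd)
  have hψs : tsupport (fun p : ℝ × EuclideanSpace ℝ (Fin N) => θ p.1 * φ p.2) ⊆
      tsupport θ ×ˢ tsupport φ := by
    refine closure_minimal (fun p hp => ?_) ((isClosed_tsupport _).prod (isClosed_tsupport _))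
    exact ⟨subset_tsupport _ (left_ne_zero_of_mul hp), subset_tsupport _ (right_ne_zero_of_mul hp)⟩
  have hψc : HasCompactSupport fun p : ℝ × EuclideanSpace ℝ (Fin N) => θ p.1 * φ p.2 :=
    (hθc.isCompact.prod hφc.isCompact).of_isClosed_subset (isClosed_tsupport _) hψs
  refine Eq.trans (integral_congr_ae ?_)
    (hu.equation _ hψ hψc (hψs.trans (prod_mono hθ0 (subset_univ _))))
  filter_upwards [huU] with t ht
  have hui : Integrable (u t) := (hUi t).congr ht.symm
  have h1 : Integrable fun x => deriv θ t * (u t x * φ x) :=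
    (hui.mul_bdd (c := c) hφ.continuous.aestronglyMeasurable (Eventually.of_forall hc)).const_mul _
  have hL : Integrable fun x => jumpOperator κ (U t) φ x := (hUφ t).integral_prod_left
  have h2 : Integrable fun x => θ t * (U t x * jumpOperator κ (U t) φ x) :=
    (hL.bdd_mul (c := R) (hUm t).aestronglyMeasurable (Eventually.of_forall (hUR t))).const_mul _
  -- Symmetry puts the operator back on `φ`, as in the weak formulation.
  rw [← hκ.integral_mul_jumpOperator_comm (hUm t) hφ.continuous.measurable (hUR t) hc (hUU t)
    (hUφ t), ← integral_const_mul, ← integral_const_mul, ← integral_sub h1 h2]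
  refine integral_congr_ae ?_
  filter_upwards [ht, jumpOperator_const_mul_ae_eq (κ := κ) ht (θ t) φ] with x hx hxL
  have hd : deriv (fun s => θ s * φ x) t = deriv θ t * φ x :=
    deriv_mul_const ((hθ.differentiable (by simp)) t) _
  simp only [hxL, hd, hx]
  ring

/-- Strong solutions solve the equation in integrated form. -/
theorem IsStrongSolution.exists_representation {N : ℕ} (hN : 1 ≤ N)
    {κ : ℝ → ℝ → EuclideanSpace ℝ (Fin N) → EuclideanSpace ℝ (Fin N) → ℝ}
    {u₀ : EuclideanSpace ℝ (Fin N) → ℝ} {u : ℝ → EuclideanSpace ℝ (Fin N) → ℝ}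
    (hκ : IsHomogeneousJumpKernel κ) (hu₀ : Integrable u₀) (hu : IsStrongSolution κ u₀ u) :
    ∃ U : ℝ → EuclideanSpace ℝ (Fin N) → ℝ,
      Measurable (fun p : ℝ × EuclideanSpace ℝ (Fin N) => U p.1 p.2) ∧
      (∀ t, Integrable (jumpFlux κ (U t) (U t))) ∧
      (∀ t, Integrable (fun p : ℝ × EuclideanSpace ℝ (Fin N) =>
        jumpOperator κ (U p.1) (U p.1) p.2) ((volume.restrict (Ioc 0 t)).prod volume)) ∧
      (∀ᵐ t ∂volume.restrict (Ioi (0 : ℝ)), u t =ᵐ[volume] U t) ∧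
      ∀ t, 0 ≤ t → ∀ᵐ x, u t x = u₀ x - ∫ s in Ioc 0 t, jumpOperator κ (U s) (U s) x := by
  obtain ⟨U, R, C, hR, hUm, hUR, hUi, hUt, huU⟩ := hu.exists_measurable_representative
  obtain ⟨m, hm, hmi, hκm⟩ := hκ.exists_majorant hN hR
  have hUm' : ∀ t, Measurable (U t) := fun t => hUm.comp measurable_prodMk_left
  set K : ℝ≥0∞ := C * ∫⁻ z, min 1 ‖z‖ₑ * m z with hK
  have hKt : K ≠ ⊤ := ENNReal.mul_ne_top (by simp) hmi
  have hUK : ∀ t, ∫⁻ p, ‖jumpFlux κ (U t) (U t) p‖ₑ ≤ K := fun t =>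
    IsHomogeneousJumpKernel.lintegral_jumpFlux_le hm hκm (hUR t) (hUm' t) (hUt t)
  have hUU : ∀ t, Integrable (jumpFlux κ (U t) (U t)) := fun t =>
    ⟨(hκ.measurable_jumpFlux (hUm' t) (hUm' t)).aestronglyMeasurable,
      (hUK t).trans_lt hKt.lt_top⟩
  have hGi := integrable_jumpOperator_prod hκ hUm hKt hUK
  refine ⟨U, hUm, hUU, hGi, huU, fun t ht => ?_⟩
  refine ae_eq_of_integral_contDiff_smul_eq (hu.locallyIntegrable t ht)
    (hu₀.sub (hGi t).integral_prod_right).locallyIntegrable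
    fun (φ : EuclideanSpace ℝ (Fin N) → ℝ) hφ hφc => ?_
  obtain ⟨c, hc⟩ := hφc.exists_bound_of_continuous hφ.continuous
  obtain ⟨Cφ, hCφ, hφt⟩ := exists_lintegral_translate_sub_le_of_contDiff (μ := volume) hφ hφc
  have hUφ : ∀ t, Integrable (jumpFlux κ (U t) φ) := fun t =>
    ⟨(hκ.measurable_jumpFlux (hUm' t) hφ.continuous.measurable).aestronglyMeasurable,
      (IsHomogeneousJumpKernel.lintegral_jumpFlux_le hm hκm (hUR t) hφ.continuous.measurable
        hφt).trans_lt (ENNReal.mul_lt_top hCφ.lt_top hmi.lt_top)⟩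
  set B : ℝ → ℝ := fun t => ∫ x, φ x * jumpOperator κ (U t) (U t) x with hB
  have hBm : Measurable B :=
    (((hφ.continuous.measurable.comp measurable_snd).mul
      (hκ.measurable_jumpOperator hUm)).stronglyMeasurable.integral_prod_right
        (ν := volume)).measurable
  have hBb : ∀ t, |B t| ≤ c * K.toReal := by
    intro t
    have hc0 : 0 ≤ c := (norm_nonneg _).trans (hc 0)
    have hLi : Integrable fun x => jumpOperator κ (U t) (U t) x := (hUU t).integral_prod_left
    calc |B t| ≤ ∫ x, c * ‖jumpOperator κ (U t) (U t) x‖ := by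
          rw [← Real.norm_eq_abs]
          refine norm_integral_le_of_norm_le (hLi.norm.const_mul c) (Eventually.of_forall fun x => ?_)
          rw [norm_mul]
          gcongr
          exact hc x
      _ ≤ c * K.toReal := by
          rw [integral_const_mul, integral_norm_eq_lintegral_enorm hLi.1]
          gcongr
          exact (lintegral_enorm_jumpOperator_le
            (hκ.measurable_jumpFlux (hUm' t) (hUm' t))).trans (hUK t)
  -- Continuity of the pairing in time makes the identity hold at every `t`, not just almost every
  -- `t`.
  have key := eq_sub_integral_of_weak_deriv (hu.continuousOn_integral_mul hφ.continuous hφc) hBm hBb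
    (fun θ hθ hθc hθ0 => hu.integral_deriv_mul_sub_eq_zero hκ hUm' hUR hUi huU hUU hφ hφc hUφ
      hθ hθc hθ0) ht
  have hφG : Integrable (fun p : ℝ × EuclideanSpace ℝ (Fin N) =>
      φ p.2 * jumpOperator κ (U p.1) (U p.1) p.2) ((volume.restrict (Ioc 0 t)).prod volume) :=
    (hGi t).bdd_mul (c := c) (hφ.continuous.comp continuous_snd).aestronglyMeasurable
      (Eventually.of_forall fun p => hc _)
  have hswap : ∫ s in 0..t, B s = ∫ x, φ x * ∫ s in Ioc 0 t, jumpOperator κ (U s) (U s) x := by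
    rw [intervalIntegral.integral_of_le ht]
    rw [integral_integral_swap (f := fun s x => φ x * jumpOperator κ (U s) (U s) x) hφG]
    simp_rw [integral_const_mul]
  rw [hu.integral_zero_mul hu₀ hφ.continuous hφc, hswap, ← integral_sub] at key
  · simp only [smul_eq_mul]
    simp_rw [mul_comm (φ _) (u t _)]
    rw [key]
    refine integral_congr_ae (Eventually.of_forall fun x => ?_)
    ring
  · exact hu₀.mul_bdd (c := c) hφ.continuous.aestronglyMeasurable (Eventually.of_forall hc)
  · exact (hGi t).integral_prod_right.bdd_mul (c := c) hφ.continuous.aestronglyMeasurable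
      (Eventually.of_forall hc)

/-! ### Contraction and comparison -/

/-- T-contraction in `L¹` for functions that evolve by integrated equations with a T-accretive
right-hand side. -/
theorem integral_max_zero_sub_integral_le {E : Type*} [MeasurableSpace E] {μ : Measure E}
    [SFinite μ] {w₀ : E → ℝ} (hw₀ : Integrable w₀ μ) {g Z : ℝ → E → ℝ} {t : ℝ} (ht : 0 ≤ t)
    (hgm : Measurable fun p : ℝ × E => g p.1 p.2) (hZm : Measurable fun p : ℝ × E => Z p.1 p.2)
    (hg : Integrable (fun p : ℝ × E => g p.1 p.2) ((volume.restrict (Ioc 0 t)).prod μ))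
    (hZ : ∀ᵐ s ∂volume.restrict (Ioc 0 t), ∀ᵐ x ∂μ, w₀ x - ∫ r in Ioc 0 s, g r x = Z s x)
    (hacc : ∀ s, 0 ≤ ∫ x, {x | 0 < Z s x}.indicator 1 x * g s x ∂μ) :
    ∫ x, max (w₀ x - ∫ s in Ioc 0 t, g s x) 0 ∂μ ≤ ∫ x, max (w₀ x) 0 ∂μ := by
  set w₁ := hw₀.1.mk w₀ with hw₁
  have hw₁m : Measurable w₁ := hw₀.1.stronglyMeasurable_mk.measurable
  -- The fixed domain with a cutoff `r ≤ s` makes `W` visibly jointly measurable.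
  set W : ℝ → E → ℝ := fun s x => w₁ x - ∫ r in Ioc 0 t, if r ≤ s then g r x else 0 with hW
  have hWm : Measurable fun p : ℝ × E => W p.1 p.2 := by
    have h1 : Measurable fun q : (ℝ × E) × ℝ => if q.2 ≤ q.1.1 then g q.2 q.1.2 else 0 :=
      Measurable.ite (measurableSet_le measurable_snd (measurable_fst.comp measurable_fst))
        (hgm.comp (measurable_snd.prodMk (measurable_snd.comp measurable_fst))) measurable_const
    exact (hw₁m.comp measurable_snd).sub
      (h1.stronglyMeasurable.integral_prod_right (ν := volume.restrict (Ioc 0 t))).measurable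
  have hWs : ∀ s ∈ Ioc 0 t, ∀ x, W s x = w₁ x - ∫ r in Ioc 0 s, g r x := by
    intro s hs x
    simp only [hW]
    congr 1
    have : (fun r => if r ≤ s then g r x else 0) = (Iic s).indicator fun r => g r x := by
      ext r; simp [indicator]
    rw [this, setIntegral_indicator measurableSet_Iic, Ioc_inter_Iic, min_eq_right hs.2]
  -- The chain rule acts at fixed `x`, so the quantifiers of `hZ` are exchanged; this needs the
  -- equality set to be measurable.
  have hWZ : ∀ᵐ x ∂μ, ∀ᵐ s ∂volume.restrict (Ioc 0 t), W s x = Z s x := by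
    rw [← Measure.ae_ae_comm (p := fun s x => W s x = Z s x) (measurableSet_eq_fun hWm hZm)]
    filter_upwards [hZ, ae_restrict_mem measurableSet_Ioc] with s hs hst
    filter_upwards [hs, hw₀.1.ae_eq_mk] with x hx hx'
    rw [hWs s hst, ← hx, hx']
  set q : ℝ × E → ℝ := fun p => {x | 0 < Z p.1 x}.indicator 1 p.2 * g p.1 p.2 with hq
  have hqi : Integrable q ((volume.restrict (Ioc 0 t)).prod μ) := by
    refine hg.bdd_mul (c := 1) ?_ (Eventually.of_forall fun p => ?_)
    · have : (fun p : ℝ × E => {x | 0 < Z p.1 x}.indicator (1 : E → ℝ) p.2) =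
          {p : ℝ × E | 0 < Z p.1 p.2}.indicator 1 := by
        ext p; simp [indicator]
      rw [this]
      exact (measurable_one.indicator (measurableSet_lt measurable_const hZm)).aestronglyMeasurable
    · by_cases h : 0 < Z p.1 p.2 <;> simp [indicator, h]
  have hpt : ∀ᵐ x ∂μ, max (w₀ x - ∫ s in Ioc 0 t, g s x) 0 =
      max (w₀ x) 0 - ∫ s in Ioc 0 t, q (s, x) := by
    filter_upwards [hWZ, hw₀.1.ae_eq_mk, hg.prod_left_ae] with x hx hx' hgx
    have h1 := max_zero_sub_integral (g := fun s => g s x) (T := t)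
      ((intervalIntegrable_iff_integrableOn_Ioc_of_le ht).2 hgx) (w₀ x)
    rw [intervalIntegral.integral_of_le ht, intervalIntegral.integral_of_le ht] at h1
    rw [h1]
    congr 1
    refine integral_congr_ae ?_
    filter_upwards [hx, ae_restrict_mem measurableSet_Ioc] with s hs hst
    have h2 : w₀ x - ∫ r in 0..s, g r x = Z s x := by
      rw [← hs, hWs s hst, intervalIntegral.integral_of_le hst.1.le, hx']
    simp only [hq, indicator, mem_ofPred_eq, h2, Pi.one_apply]
    split_ifs <;> simp
  have hpos : Integrable (fun x => max (w₀ x) 0) μ := hw₀.pos_part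
  rw [integral_congr_ae hpt, integral_sub hpos hqi.integral_prod_right,
    ← integral_integral_swap (f := fun s x => q (s, x)) hqi]
  exact sub_le_self _ (integral_nonneg hacc)

/-- Subtracting the two representations leaves an integrated equation with right-hand side `𝓛_U U -
𝓛_V V`, to which accretivity applies. It also yields integrability at each time, where the solutions
are only assumed locally integrable. -/
theorem IsStrongSolution.integrable_sub_and_integral_max_zero_sub_le {N : ℕ} (hN : 1 ≤ N)
    {κ : ℝ → ℝ → EuclideanSpace ℝ (Fin N) → EuclideanSpace ℝ (Fin N) → ℝ}
    (hκ : IsHomogeneousJumpKernel κ)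
    {u₀ v₀ : EuclideanSpace ℝ (Fin N) → ℝ} (hu₀ : Integrable u₀) (hv₀ : Integrable v₀)
    {u v : ℝ → EuclideanSpace ℝ (Fin N) → ℝ}
    (hu : IsStrongSolution κ u₀ u) (hv : IsStrongSolution κ v₀ v) {t : ℝ} (ht : 0 ≤ t) :
    Integrable (fun x => u t x - v t x) ∧
      ∫ x, max (u t x - v t x) 0 ≤ ∫ x, max (u₀ x - v₀ x) 0 := by
  obtain ⟨U, hUm, hUU, hUi, hUu, hUr⟩ := hu.exists_representation hN hκ hu₀
  obtain ⟨V, hVm, hVV, hVi, hVv, hVr⟩ := hv.exists_representation hN hκ hv₀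
  set g : ℝ → EuclideanSpace ℝ (Fin N) → ℝ := fun s x =>
    jumpOperator κ (U s) (U s) x - jumpOperator κ (V s) (V s) x with hg
  have hgi : ∀ t, Integrable (fun p : ℝ × EuclideanSpace ℝ (Fin N) => g p.1 p.2)
      ((volume.restrict (Ioc 0 t)).prod volume) := fun t => (hUi t).sub (hVi t)
  have hw : ∀ s, 0 ≤ s → ∀ᵐ x, u s x - v s x = (u₀ x - v₀ x) - ∫ r in Ioc 0 s, g r x := by
    intro s hs
    filter_upwards [hUr s hs, hVr s hs, (hUi s).prod_left_ae, (hVi s).prod_left_ae]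
      with x h1 h2 h3 h4
    rw [h1, h2, integral_sub h3 h4]
    ring
  refine ⟨((hu₀.sub hv₀).sub (hgi t).integral_prod_right).congr
    ((hw t ht).mono fun x hx => hx.symm), ?_⟩
  have key := integral_max_zero_sub_integral_le (hu₀.sub hv₀) ht
    ((hκ.measurable_jumpOperator hUm).sub (hκ.measurable_jumpOperator hVm)) (hUm.sub hVm)
    (hgi t) (Z := fun s x => U s x - V s x) ?_ ?_
  · refine le_of_eq_of_le (integral_congr_ae ?_) key
    filter_upwards [hw t ht] with x hx
    rw [hx]
    rfl
  · have hle : volume.restrict (Ioc 0 t) ≤ volume.restrict (Ioi (0 : ℝ)) :=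
      Measure.restrict_mono Ioc_subset_Ioi_self le_rfl
    filter_upwards [ae_mono hle hUu, ae_mono hle hVv, ae_restrict_mem measurableSet_Ioc]
      with s h1 h2 hs
    filter_upwards [h1, h2, hw s hs.1.le] with x hx1 hx2 hx3
    rw [← hx1, ← hx2, hx3]
    rfl
  · intro s
    refine le_of_le_of_eq (hκ.integral_indicator_mul_jumpOperator_sub_nonneg
      (u := U s) (v := V s) (hUm.comp measurable_prodMk_left) (hVm.comp measurable_prodMk_left) (hUU s) (hVV s)) ?_
    refine integral_congr_ae ?_
    filter_upwards [(hUU s).prod_right_ae, (hVV s).prod_right_ae] with x h1 h2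
    rw [integral_sub h1 h2]
    simp only [indicator, mem_ofPred_eq, sub_pos]
    rfl

theorem mainTheorem5 {N : ℕ} (hN : 1 ≤ N)
    (κ : ℝ → ℝ → EuclideanSpace ℝ (Fin N) → EuclideanSpace ℝ (Fin N) → ℝ)
    (hκ : IsHomogeneousJumpKernel κ)
    (u₀ v₀ : EuclideanSpace ℝ (Fin N) → ℝ)
    (hu₀ : MemBV u₀) (hu₀' : MemLp u₀ ∞ volume)
    (hv₀ : MemBV v₀) (hv₀' : MemLp v₀ ∞ volume)
    (u v : ℝ → EuclideanSpace ℝ (Fin N) → ℝ)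
    (hu : IsStrongSolution κ u₀ u) (hv : IsStrongSolution κ v₀ v) :
    (∀ t : ℝ, 0 < t →
      eLpNorm (fun x => u t x - v t x) 1 volume ≤ eLpNorm (fun x => u₀ x - v₀ x) 1 volume) ∧
    ((∀ᵐ x, u₀ x = v₀ x) → ∀ t : ℝ, 0 ≤ t → ∀ᵐ x, u t x = v t x) ∧
    ((∀ᵐ x, u₀ x ≤ v₀ x) → ∀ t : ℝ, 0 ≤ t → ∀ᵐ x, u t x ≤ v t x) := by
  have hui := memLp_one_iff_integrable.1 hu₀.1
  have hvi := memLp_one_iff_integrable.1 hv₀.1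
  have comparison : ∀ {u₀ v₀ : EuclideanSpace ℝ (Fin N) → ℝ}
      {u v : ℝ → EuclideanSpace ℝ (Fin N) → ℝ}, Integrable u₀ → Integrable v₀ →
      IsStrongSolution κ u₀ u → IsStrongSolution κ v₀ v → (∀ᵐ x, u₀ x ≤ v₀ x) →
      ∀ t : ℝ, 0 ≤ t → ∀ᵐ x, u t x ≤ v t x := by
    intro u₀ v₀ u v hui hvi hu hv hle t ht
    obtain ⟨hi, hmax⟩ := hu.integrable_sub_and_integral_max_zero_sub_le hN hκ hui hvi hv ht
    have h0 : ∫ x, max (u₀ x - v₀ x) 0 = 0 := by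
      refine integral_eq_zero_of_ae ?_
      filter_upwards [hle] with x hx
      simp [hx]
    have h1 : ∫ x, max (u t x - v t x) 0 = 0 :=
      le_antisymm (hmax.trans h0.le) (integral_nonneg fun x => le_max_right _ _)
    have h2 := (integral_eq_zero_iff_of_nonneg (fun x => le_max_right _ _) hi.pos_part).1 h1
    filter_upwards [h2] with x hx
    simpa using hx
  refine ⟨fun t ht => ?_, fun h t ht => ?_, comparison hui hvi hu hv⟩
  · obtain ⟨hi, h1⟩ := hu.integrable_sub_and_integral_max_zero_sub_le hN hκ hui hvi hv ht.le
    obtain ⟨hi', h2⟩ := hv.integrable_sub_and_integral_max_zero_sub_le hN hκ hvi hui hu ht.le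
    -- The `L¹` norm splits into the two positive parts, each controlled by one order of the
    -- solutions.
    have habs : ∀ {f g : EuclideanSpace ℝ (Fin N) → ℝ}, Integrable (fun x => f x - g x) →
        Integrable (fun x => g x - f x) → eLpNorm (fun x => f x - g x) 1 volume =
          ENNReal.ofReal ((∫ x, max (f x - g x) 0) + ∫ x, max (g x - f x) 0) := by
      intro f g hf hg
      rw [eLpNorm_one_eq_lintegral_enorm, ← ofReal_integral_norm_eq_lintegral_enorm hf,
        ← integral_add hf.pos_part hg.pos_part]
      congr 2
      ext x
      rw [Real.norm_eq_abs]
      rcases le_total (f x) (g x) with h | h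
      · rw [abs_of_nonpos (by linarith), max_eq_right (by linarith), max_eq_left (by linarith)]
        ring
      · rw [abs_of_nonneg (by linarith), max_eq_left (by linarith), max_eq_right (by linarith)]
        ring
    rw [habs hi hi', habs (hui.sub hvi) (hvi.sub hui)]
    exact ENNReal.ofReal_le_ofReal (add_le_add h1 h2)
  · filter_upwards [comparison hui hvi hu hv (h.mono fun x hx => hx.le) t ht,
      comparison hvi hui hv hu (h.mono fun x hx => hx.ge) t ht] with x h1 h2
    exact le_antisymm h1 h2
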